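/- Let $0<\delta_1<\delta_2$ be real numbers, let $N,M\ge 0$ be integers, and let $\Omega_1,\dots,\Omega_N$, $P_{N+1},\dots,P_{N+M}$ and $C_1,\dots,C_{N+M}$ be arbitrary real numbers. Put $$K_i=\tfrac12\bigl(|\Omega_i-\delta_1|-|\Omega_i+\delta_1|\bigr)\ (i\le N),\qquad Q_i=\max(0,P_i-\delta_2)+\min(0,P_i+\delta_2)\ (i>N),$$ $$\Phi_i(m,n)=\begin{cases}\Omega_i m+K_i n+C_i & (1\le i\le N),\\ Q_i m+P_i n+C_i & (N<i\le N+M),\end{cases}$$ and for $1\le i<j\le N+M$ $$B_{ij}=\begin{cases}2\max(\min(\Omega_i,-\Omega_j),\min(-\Omega_i,\Omega_j)) & (i<j\le N),\\ \max(\min(-2P_i-Q_i,2P_j+Q_j),\min(2P_i+Q_i,-2P_j-Q_j)) & (N<i<j),\\ B'_{ij} & (i\le N<j),\end{cases}$$ $$B'_{ij}=\begin{cases}-\max(\min(\Omega_i+2K_i,2Q_j),\min(\Omega_i+2K_i-P_j+\delta_2,0)) & (\Omega_i>0,\ P_j>0),\\ \max(\min(\Omega_i+2K_i,-2Q_j),\min(\Omega_i+2K_i+P_j+\delta_2,0))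 & (\Omega_i>0,\ P_j<0),\\ \max(\min(-\Omega_i-2K_i,2Q_j),\min(-\Omega_i-2K_i-P_j+\delta_2,0)) & (\Omega_i<0,\ P_j>0),\\ -\max(\min(-\Omega_i-2K_i,-2Q_j),\min(-\Omega_i-2K_i+P_j+\delta_2,0)) & (\Omega_i<0,\ P_j<0),\\ 0 & (\Omega_i=0\text{ or }P_j=0).\end{cases}$$ For $m,n\in\mathbb Z$ let $$F^m_n=\max_{I\subseteq\{1,\dots,N+M\}}\Bigl(\sum_{i\in I}\Phi_i(m,n)+\sum_{i,j\in I,\ i<j}B_{ij}\Bigr),$$ where $I=\emptyset$ contributes $0$. Then for all $m,n\in\mathbb Z$ $$F_{n+1}^{m+1}+F_{n}^{m-1}=\max\bigl(F_{n+1}^{m}+F_{n}^{m},\ F_{n}^{m+1}+F_{n+1}^{m-1}-\delta_1,\ F_{n+2}^{m}+F_{n-1}^{m}-\delta_2\bigr).$$ Moreover, let $$U^m_n=F^m_{n+1}+F^{m+1}_n-F^m_n-F^{m+1}_{n+1},\quad V^m_n=F^{m+1}_n+F^{m-1}_n-2F^m_n,\quad X^m_n=F^m_{n+1}+F^m_{n-1}-2F^m_n.$$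 If $M=0$, then for all $m,n\in\mathbb Z$: $-\delta_2+X^m_n+X^m_{n+1}<0$; $U^m_k,V^m_k,X^m_k\to0$ as $k\to-\infty$; and $U$ evolves by the Box-Ball system with box capacity $\delta_1$ and carrier $V$, that is, $0\le U^m_n\le\delta_1$, for each $m$ only finitely many $U^m_k$ are nonzero, and $$V^m_n=\sum_{k=-\infty}^{n}\bigl(U^{m-1}_{k-1}-U^m_{k-1}\bigr),\qquad U^m_n=\min\Bigl(\sum_{k=-\infty}^{n}\bigl(U^{m-1}_{k-1}-U^m_{k-1}\bigr),\ \delta_1-U^{m-1}_n\Bigr).$$ -/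

import Mathlib

noncomputable section

namespace MixedSoliton

/-- The ultradiscrete equation
`F^{m+1}_{n+1} + F^{m-1}_n
  = max (F^m_{n+1} + F^m_n, F^{m+1}_n + F^{m-1}_{n+1} - δ₁, F^m_{n+2} + F^m_{n-1} - δ₂)`
for all integers `m`, `n`; here `F m n` stands for `F^m_n`. -/
def SolvesEBB (δ₁ δ₂ : ℝ) (F : ℤ → ℤ → ℝ) : Prop :=
  ∀ m n : ℤ,
    F (m + 1) (n + 1) + F (m - 1) n =
      max (F m (n + 1) + F m n)
        (max (F (m + 1) n + F (m - 1) (n + 1) - δ₁)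
          (F m (n + 2) + F m (n - 1) - δ₂))

/-- KdV-type dispersion: `K = (|Ω - δ₁| - |Ω + δ₁|) / 2`. -/
def dispK (δ₁ Ω : ℝ) : ℝ := (|Ω - δ₁| - |Ω + δ₁|) / 2

/-- Toda-type dispersion: `Q = max (0, P - δ₂) + min (0, P + δ₂)`. -/
def dispQ (δ₂ P : ℝ) : ℝ := max 0 (P - δ₂) + min 0 (P + δ₂)

/-- Interaction of two KdV-type solitons. -/
def interKdV (Ω Ω' : ℝ) : ℝ := 2 * max (min Ω (-Ω')) (min (-Ω) Ω')

/-- Interaction of two Toda-type solitons. -/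
def interToda (δ₂ P P' : ℝ) : ℝ :=
  max (min (-2 * P - dispQ δ₂ P) (2 * P' + dispQ δ₂ P'))
    (min (2 * P + dispQ δ₂ P) (-2 * P' - dispQ δ₂ P'))

/-- Interaction of a KdV-type soliton with a Toda-type soliton.  If `Ω = 0` or `P = 0` the value
is `0`, which is the common limit of the four formulas there. -/
def interMixed (δ₁ δ₂ Ω P : ℝ) : ℝ :=
  if 0 < Ω ∧ 0 < P then
    -max (min (Ω + 2 * dispK δ₁ Ω) (2 * dispQ δ₂ P)) (min (Ω + 2 * dispK δ₁ Ω - P + δ₂) 0)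
  else if 0 < Ω ∧ P < 0 then
    max (min (Ω + 2 * dispK δ₁ Ω) (-2 * dispQ δ₂ P)) (min (Ω + 2 * dispK δ₁ Ω + P + δ₂) 0)
  else if Ω < 0 ∧ 0 < P then
    max (min (-Ω - 2 * dispK δ₁ Ω) (2 * dispQ δ₂ P)) (min (-Ω - 2 * dispK δ₁ Ω - P + δ₂) 0)
  else if Ω < 0 ∧ P < 0 then
    -max (min (-Ω - 2 * dispK δ₁ Ω) (-2 * dispQ δ₂ P)) (min (-Ω - 2 * dispK δ₁ Ω + P + δ₂) 0)
  else 0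

/-- The phase `Φ_i(m, n)`: the first `N` indices are of KdV type, the last `M` of Toda type. -/
def phase (δ₁ δ₂ : ℝ) {N M : ℕ} (Ω : Fin N → ℝ) (P : Fin M → ℝ) (C : Fin (N + M) → ℝ)
    (i : Fin (N + M)) (m n : ℤ) : ℝ :=
  Fin.addCases (motive := fun _ => ℝ)
    (fun a => Ω a * m + dispK δ₁ (Ω a) * n)
    (fun b => dispQ δ₂ (P b) * m + P b * n) i + C i

/-- The interaction factor `B_ij`.  It is used only for `i < j`, so the case of `i` of
Toda type and `j` of KdV type never enters. -/
def inter (δ₁ δ₂ : ℝ) {N M : ℕ} (Ω : Fin N → ℝ) (P : Fin M → ℝ) (i j : Fin (N + M)) : ℝ :=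
  Fin.addCases (motive := fun _ => ℝ)
    (fun a => Fin.addCases (motive := fun _ => ℝ)
      (fun a' => interKdV (Ω a) (Ω a'))
      (fun b' => interMixed δ₁ δ₂ (Ω a) (P b')) j)
    (fun b => Fin.addCases (motive := fun _ => ℝ)
      (fun a' => interMixed δ₁ δ₂ (Ω a') (P b))
      (fun b' => interToda δ₂ (P b) (P b')) j) i

/-- The function `F^m_n`, a maximum over all subsets `I` of the `N + M` indices (the empty
subset contributes `0`). -/
def mixedSoliton (δ₁ δ₂ : ℝ) {N M : ℕ} (Ω : Fin N → ℝ) (P : Fin M → ℝ) (C : Fin (N + M) → ℝ)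
    (m n : ℤ) : ℝ :=
  (Finset.univ : Finset (Finset (Fin (N + M)))).sup' Finset.univ_nonempty fun I =>
    ∑ i ∈ I, phase δ₁ δ₂ Ω P C i m n +
      ∑ i ∈ I, ∑ j ∈ I with i < j, inter δ₁ δ₂ Ω P i j

/-- `U^m_n = F^m_{n+1} + F^{m+1}_n - F^m_n - F^{m+1}_{n+1}`. -/
def fieldU (F : ℤ → ℤ → ℝ) (m n : ℤ) : ℝ :=
  F m (n + 1) + F (m + 1) n - F m n - F (m + 1) (n + 1)

/-- `V^m_n = F^{m+1}_n + F^{m-1}_n - 2 F^m_n`. -/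
def fieldV (F : ℤ → ℤ → ℝ) (m n : ℤ) : ℝ :=
  F (m + 1) n + F (m - 1) n - 2 * F m n

/-- `X^m_n = F^m_{n+1} + F^m_{n-1} - 2 F^m_n`. -/
def fieldX (F : ℤ → ℤ → ℝ) (m n : ℤ) : ℝ :=
  F m (n + 1) + F m (n - 1) - 2 * F m n

/-- A state of the Box-Ball system with box capacity `δ`: the content of each box is between `0`
and `δ`, and all but finitely many boxes are empty. -/
structure IsBoxBallState (δ : ℝ) (u : ℤ → ℝ) : Prop where
  nonneg : ∀ n, 0 ≤ u n
  le_capacity : ∀ n, u n ≤ δ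
  finite_support : (Function.support u).Finite

/-- The carrier load `∑_{k ≤ n} (u_{k-1} - u'_{k-1})` on arrival at box `n`, when the state `u`
is being changed to the state `u'`. -/
def carrierLoad (u u' : ℤ → ℝ) (n : ℤ) : ℝ :=
  ∑ᶠ (k : ℤ) (_ : k ≤ n), (u (k - 1) - u' (k - 1))

/-- `U` is an orbit of the Box-Ball system with box capacity `δ`: each `U m` is a state and
`U^m_n = min (∑_{k ≤ n} (U^{m-1}_{k-1} - U^m_{k-1}), δ - U^{m-1}_n)`. -/
structure IsBoxBallEvolution (δ : ℝ) (U : ℤ → ℤ → ℝ) : Prop where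
  state : ∀ m, IsBoxBallState δ (U m)
  step : ∀ m n, U m n = min (carrierLoad (U (m - 1)) (U m) n) (δ - U (m - 1) n)

end MixedSoliton

end

/-!
The maxima in `F^{m₁}_{n₁} + F^{m₂}_{n₂}` are attained at two subsets `I`, `J`. Exchanging elements
between `I` and `J` keeps `χ_I + χ_J` and reverses some of the spins `χ_I - χ_J`, so inequalities
between such sums with the same `m₁ + m₂` and `n₁ + n₂` reduce to inequalities between the energies
of spin configurations that differ by flips.

These energies are integrals over a height `u > 0`, cut at `δ₂ - δ₁` and `δ₂`. A soliton occupies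
intervals of heights whose lengths account for its dispersion, and the interaction of two solitons
is an overlap of such intervals. Hence the density at height `u` is a quadratic polynomial in the
sums of the spins that are present at `u`, and the parities of these sums do not depend on the signs
of the spins. Listing the spins by decreasing parameter and choosing signs, one can make their
partial sums follow any path with steps `±1`. The alternating path `0, 1, 0, 1, …` optimizes the
density along `(2, 1)` at every height, which makes the left-hand side of the equation an upper
bound. Conversely, if the optimal density along `(2, 1)` exceeds the one along `(0, 1)` at some
height, then reflecting the alternating path at the highest such `u` gives a configuration that
reaches the second or the third term on the right.

For KdV-type solitons alone the alternating path also gives `0 ≤ U ≤ δ₁` and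
`X^m_n + X^m_{n+1} ≤ δ₁`, so that the third term is dominated by the first one. The equation then
reads `U^m_n = min (V^m_n) (δ₁ - U^{m-1}_n)`, and since `F^m_n` is affine near `n = ±∞`, all fields
vanish there and `V` is the telescoping sum defining the carrier load.
-/

noncomputable section

namespace MixedSoliton

section Energy

variable {ι : Type*}

/-- The configuration `τ'` arises from `τ` by reversing some of the spins. -/
def IsFlip (τ τ' : ι → ℤ) : Prop :=
  ∀ i, τ' i = τ i ∨ τ' i = -τ i

theorem IsFlip.mul {τ τ' : ι → ℤ} (h : IsFlip τ τ') (s : ι → ℤ) :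
    IsFlip (fun i => s i * τ i) (fun i => s i * τ' i) := by
  intro i
  rcases h i with h | h <;> simp [h]

section Subsets

variable [LinearOrder ι]

/-- The value of the subset `I` for phases `φ` and interactions `B`; `mixedSoliton` is the maximum
of these values. -/
def weight (φ : ι → ℝ) (B : ι → ι → ℝ) (I : Finset ι) : ℝ :=
  ∑ i ∈ I, φ i + ∑ i ∈ I, ∑ j ∈ I with i < j, B i j

/-- The indicator of a subset, with integer values. -/
def chi (I : Finset ι) (i : ι) : ℤ := if i ∈ I then 1 else 0

theorem abs_chi_sub_chi_le (I J : Finset ι) (i : ι) : |chi I i - chi J i| ≤ 1 := by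
  unfold chi
  split_ifs <;> simp

theorem sum_sum_eq_sum_diag_add_two_mul_sum_lt {B : ι → ι → ℝ} (hB : ∀ i j, B i j = B j i)
    (I : Finset ι) :
    ∑ i ∈ I, ∑ j ∈ I, B i j = ∑ i ∈ I, B i i + 2 * ∑ i ∈ I, ∑ j ∈ I with i < j, B i j := by
  have hsplit : ∀ i ∈ I, ∑ j ∈ I, B i j =
      B i i + (∑ j ∈ I with i < j, B i j + ∑ j ∈ I with j < i, B i j) := by
    intro i hi
    rw [← Finset.sum_ite_eq_of_mem I i (B i) hi]
    simp only [Finset.sum_filter, ← Finset.sum_add_distrib]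
    refine Finset.sum_congr rfl fun j _ => ?_
    rcases lt_trichotomy i j with h | rfl | h <;> simp [*, ne_of_lt, ne_of_gt, not_lt_of_gt]
  have hswap : ∑ i ∈ I, ∑ j ∈ I with j < i, B i j = ∑ i ∈ I, ∑ j ∈ I with i < j, B i j := by
    simp only [Finset.sum_filter]
    rw [Finset.sum_comm]
    simp only [hB]
  rw [Finset.sum_congr rfl hsplit, Finset.sum_add_distrib, Finset.sum_add_distrib, hswap]
  ring

theorem exists_chi_sub_chi_eq (I J : Finset ι) {τ : ι → ℤ}
    (hτ : IsFlip (fun i => chi I i - chi J i) τ) :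
    ∃ I' J' : Finset ι, (fun i => chi I' i + chi J' i) = (fun i => chi I i + chi J i) ∧
      (fun i => chi I' i - chi J' i) = τ := by
  let agree (i : ι) : Prop := τ i = chi I i - chi J i
  refine ⟨{i ∈ I | agree i} ∪ {i ∈ J | ¬agree i}, {i ∈ J | agree i} ∪ {i ∈ I | ¬agree i},
    funext fun i => ?_, funext fun i => ?_⟩
  all_goals
    have := hτ i
    simp only [chi, agree, Finset.mem_union] at *
    split_ifs at * <;> grind

end Subsets

variable [Fintype ι]

/-- The energy of a spin configuration `τ` in the field `l` with couplings `B`, diagonal terms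
included.  Spins are integers, so that `0` marks the indices that do not take part. -/
def spinEnergy (l : ι → ℝ) (B : ι → ι → ℝ) (τ : ι → ℤ) : ℝ :=
  2 * ∑ i, (τ i : ℝ) * l i + ∑ i, ∑ j, (τ i : ℝ) * τ j * B i j

theorem spinEnergy_mul (l : ι → ℝ) (B : ι → ι → ℝ) (s τ : ι → ℤ) :
    spinEnergy l B (fun i => s i * τ i) =
      spinEnergy (fun i => s i * l i) (fun i j => s i * s j * B i j) τ := by
  simp only [spinEnergy]
  congr 1
  · congr 1
    exact Finset.sum_congr rfl fun i _ => by push_cast; ring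
  · exact Finset.sum_congr rfl fun i _ => Finset.sum_congr rfl fun j _ => by push_cast; ring

variable [LinearOrder ι]

/-- The maximum of `weight` over all subsets. -/
def maxWeight (φ : ι → ℝ) (B : ι → ι → ℝ) : ℝ :=
  (Finset.univ : Finset (Finset ι)).sup' Finset.univ_nonempty (weight φ B)

theorem weight_le_maxWeight (φ : ι → ℝ) (B : ι → ι → ℝ) (I : Finset ι) :
    weight φ B I ≤ maxWeight φ B :=
  Finset.le_sup' (weight φ B) (Finset.mem_univ I)

theorem exists_maxWeight_eq (φ : ι → ℝ) (B : ι → ι → ℝ) :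
    ∃ I, maxWeight φ B = weight φ B I := by
  obtain ⟨I, -, h⟩ := Finset.exists_mem_eq_sup' Finset.univ_nonempty (weight φ B)
  exact ⟨I, h⟩

theorem sum_chi_mul (I : Finset ι) (f : ι → ℝ) : ∑ i, (chi I i : ℝ) * f i = ∑ i ∈ I, f i := by
  simp [chi, Finset.sum_ite_mem]

theorem two_mul_weight {B : ι → ι → ℝ} (hB : ∀ i j, B i j = B j i) (φ : ι → ℝ) (I : Finset ι) :
    2 * weight φ B I = ∑ i, (chi I i : ℝ) * (2 * φ i - B i i) +
      ∑ i, ∑ j, (chi I i : ℝ) * chi I j * B i j := by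
  simp only [mul_assoc, ← Finset.mul_sum, sum_chi_mul, sum_sum_eq_sum_diag_add_two_mul_sum_lt hB,
    Finset.sum_sub_distrib, weight]
  ring

theorem four_mul_weight_add_weight {B : ι → ι → ℝ} (hB : ∀ i j, B i j = B j i) (φ ψ : ι → ℝ)
    (I J : Finset ι) :
    4 * (weight φ B I + weight ψ B J) =
      spinEnergy (fun i => φ i + ψ i - B i i) B (fun i => chi I i + chi J i) +
      spinEnergy (fun i => φ i - ψ i) B (fun i => chi I i - chi J i) := by
  have hI := two_mul_weight hB φ I
  have hJ := two_mul_weight hB ψ J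
  have hlin : 2 * ∑ i, (chi I i : ℝ) * (2 * φ i - B i i) +
      2 * ∑ i, (chi J i : ℝ) * (2 * ψ i - B i i) =
      2 * ∑ i, ((chi I i + chi J i : ℤ) : ℝ) * (φ i + ψ i - B i i) +
      2 * ∑ i, ((chi I i - chi J i : ℤ) : ℝ) * (φ i - ψ i) := by
    simp only [Finset.mul_sum, ← Finset.sum_add_distrib]
    exact Finset.sum_congr rfl fun i _ => by push_cast; ring
  have hquad : 2 * ∑ i, ∑ j, (chi I i : ℝ) * chi I j * B i j +
      2 * ∑ i, ∑ j, (chi J i : ℝ) * chi J j * B i j =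
      ∑ i, ∑ j, ((chi I i + chi J i : ℤ) : ℝ) * (chi I j + chi J j : ℤ) * B i j +
      ∑ i, ∑ j, ((chi I i - chi J i : ℤ) : ℝ) * (chi I j - chi J j : ℤ) * B i j := by
    simp only [Finset.mul_sum, ← Finset.sum_add_distrib]
    exact Finset.sum_congr rfl fun i _ => Finset.sum_congr rfl fun j _ => by push_cast; ring
  simp only [spinEnergy]
  linarith

/-- Any two subsets form a spin configuration `χ_I - χ_J`, and reversing a spin means exchanging
the index between `I` and `J`; this does not affect `χ_I + χ_J`. -/
theorem exists_spin_maxWeight_add_le {B : ι → ι → ℝ} (hB : ∀ i j, B i j = B j i) (φ ψ : ι → ℝ) :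
    ∃ τ : ι → ℤ, (∀ i, |τ i| ≤ 1) ∧ ∀ (φ' ψ' : ι → ℝ) (τ' : ι → ℤ) (c : ℝ),
      (∀ i, φ i + ψ i = φ' i + ψ' i) → IsFlip τ τ' →
      spinEnergy (fun i => φ i - ψ i) B τ ≤ spinEnergy (fun i => φ' i - ψ' i) B τ' + 4 * c →
      maxWeight φ B + maxWeight ψ B ≤ maxWeight φ' B + maxWeight ψ' B + c := by
  obtain ⟨I, hI⟩ := exists_maxWeight_eq φ B
  obtain ⟨J, hJ⟩ := exists_maxWeight_eq ψ B
  refine ⟨_, abs_chi_sub_chi_le I J, fun φ' ψ' τ' c hsum hflip hle => ?_⟩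
  obtain ⟨I', J', hadd, hsub⟩ := exists_chi_sub_chi_eq I J hflip
  have hIJ := four_mul_weight_add_weight hB φ ψ I J
  have hIJ' := four_mul_weight_add_weight hB φ' ψ' I' J'
  rw [hadd, hsub] at hIJ'
  simp only [hsum] at hIJ
  linarith [weight_le_maxWeight φ' B I', weight_le_maxWeight ψ' B J']

end Energy

section Path

/-- A path of integers starting at `0` with steps `1` and `-1`. -/
def IsPath (g : ℕ → ℤ) : Prop :=
  g 0 = 0 ∧ ∀ n, g (n + 1) - g n = 1 ∨ g (n + 1) - g n = -1

theorem IsPath.neg {g : ℕ → ℤ} (h : IsPath g) : IsPath fun n => -g n := by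
  refine ⟨by simp [h.1], fun n => ?_⟩
  have := h.2 n
  grind

/-- The path `0, 1, 0, 1, …`. -/
def parity (n : ℕ) : ℤ := (n : ℤ) % 2

/-- The path `parity`, reflected in its value at `n` from the time `n` on. -/
def reflectedParity (n k : ℕ) : ℤ := if k ≤ n then parity k else 2 * parity n - parity k

theorem isPath_parity : IsPath parity := by
  refine ⟨rfl, fun k => ?_⟩
  unfold parity
  omega

theorem isPath_reflectedParity (n : ℕ) : IsPath (reflectedParity n) := by
  refine ⟨by simp [reflectedParity, parity], fun k => ?_⟩
  unfold reflectedParity parity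
  split_ifs <;> omega

theorem reflectedParity_of_le {n k : ℕ} (h : k ≤ n) : reflectedParity n k = parity k := if_pos h

theorem reflectedParity_of_ge {n k : ℕ} (h : n ≤ k) :
    reflectedParity n k = 2 * parity n - parity k := by
  rcases h.eq_or_lt with rfl | h
  · rw [reflectedParity_of_le le_rfl]
    ring
  · exact if_neg h.not_ge

open Classical in
/-- Choosing the signs in the order of decreasing `q` makes the partial sums follow `g`. -/
theorem exists_sign_of_isPath {ι α : Type*} [LinearOrder α] (D : Finset ι) (q : ι → α) {g : ℕ → ℤ}
    (hg : IsPath g) :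
    ∃ t : ι → ℤ, (∀ i, t i = 1 ∨ t i = -1) ∧ ∀ S : Set α, IsUpperSet S →
      ∑ i ∈ D with q i ∈ S, t i = g (D.filter (q · ∈ S)).card := by
  induction D using Finset.induction_on_min_value q with
  | empty => exact ⟨1, fun _ => Or.inl rfl, fun S _ => by simp [hg.1]⟩
  | insert a D ha hmin ih =>
    obtain ⟨t, ht, hsum⟩ := ih
    refine ⟨Function.update t a (g (D.card + 1) - g D.card), fun i => ?_, fun S hS => ?_⟩
    · rcases eq_or_ne i a with rfl | h
      · simpa using hg.2 D.card
      · simpa [h] using ht i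
    have hoff : ∀ E ⊆ D, ∑ i ∈ E, Function.update t a (g (D.card + 1) - g D.card) i =
        ∑ i ∈ E, t i := fun E hE =>
      Finset.sum_congr rfl fun i hi =>
        Function.update_of_ne (ne_of_mem_of_not_mem (hE hi) ha) _ _
    by_cases haS : q a ∈ S
    · have hD : D.filter (q · ∈ S) = D := Finset.filter_true_of_mem fun i hi => hS (hmin i hi) haS
      have hDg := hsum S hS
      rw [hD] at hDg
      rw [Finset.filter_insert, if_pos haS, hD, Finset.sum_insert ha, hoff D subset_rfl, hDg,
        Finset.card_insert_of_notMem ha, Function.update_self]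
      ring
    · rw [Finset.filter_insert, if_neg haS, hoff _ (Finset.filter_subset _ _), hsum S hS]

end Path

section SpinSum

variable {ι : Type*} [Fintype ι]

open Classical in
/-- The sum of the spins whose parameter lies in `S`. -/
def spinSum (τ : ι → ℤ) (q : ι → ℝ) (S : Set ℝ) : ℤ := ∑ i with q i ∈ S, τ i

open Classical in
/-- The number of nonzero spins whose parameter lies in `S`. -/
def spinCount (τ : ι → ℤ) (q : ι → ℝ) (S : Set ℝ) : ℕ :=
  (Finset.univ.filter fun i => τ i ≠ 0 ∧ q i ∈ S).card

theorem spinCount_mono (τ : ι → ℤ) (q : ι → ℝ) : Monotone (spinCount τ q) := by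
  classical
  exact fun S S' h => Finset.card_le_card
    (Finset.monotone_filter_right _ fun i _ hi => ⟨hi.1, h hi.2⟩)

theorem spinCount_congr (τ : ι → ℤ) (q : ι → ℝ) {S S' : Set ℝ} (h : ∀ i, q i ∈ S ↔ q i ∈ S') :
    spinCount τ q S = spinCount τ q S' := by
  classical
  exact congrArg Finset.card (Finset.filter_congr fun i _ => and_congr_right fun _ => h i)

theorem spinCount_eq_zero (τ : ι → ℤ) {q : ι → ℝ} {S : Set ℝ} (h : ∀ i, q i ∉ S) :
    spinCount τ q S = 0 := by
  simp [spinCount, h]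

theorem spinSum_cast (τ : ι → ℤ) (q : ι → ℝ) (S : Set ℝ) :
    (spinSum τ q S : ℝ) = ∑ i, τ i * S.indicator (1 : ℝ → ℝ) (q i) := by
  classical
  rw [spinSum, Int.cast_sum, Finset.sum_filter]
  refine Finset.sum_congr rfl fun i _ => ?_
  by_cases h : q i ∈ S <;> simp [h]

open Classical in
theorem spinSum_eq_sum_filter {τ τ' t : ι → ℤ} {q : ι → ℝ} {S : Set ℝ}
    (h0 : ∀ i, τ i = 0 → τ' i = 0) (ht : ∀ i, τ i ≠ 0 → q i ∈ S → τ' i = t i) :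
    spinSum τ' q S = ∑ i with τ i ≠ 0 ∧ q i ∈ S, t i := by
  simp only [spinSum, Finset.sum_filter]
  refine Finset.sum_congr rfl fun i _ => ?_
  by_cases hi : τ i = 0 <;> by_cases hS : q i ∈ S <;> simp [hi, hS, h0, ht]

theorem spinSum_emod_two {τ : ι → ℤ} (hτ : ∀ i, |τ i| ≤ 1) (q : ι → ℝ) (S : Set ℝ) :
    spinSum τ q S % 2 = parity (spinCount τ q S) := by
  classical
  rw [spinSum_eq_sum_filter (fun _ h => h) (fun _ _ _ => rfl), parity, spinCount,
    Finset.card_eq_sum_ones, Nat.cast_sum]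
  refine Int.ModEq.sum fun i hi => ?_
  have := (Finset.mem_filter.mp hi).2.1
  rcases Int.abs_le_one_iff.mp (hτ i) with h | h | h
  · exact absurd h this
  · simp [h]
  · rw [h]
    rfl

theorem exists_isFlip_spinSum_eq {τ : ι → ℤ} (hτ : ∀ i, |τ i| ≤ 1) {ω p : ι → ℝ}
    (hωp : ∀ i, ω i = 0 ∨ p i = 0) {g h : ℕ → ℤ} (hg : IsPath g) (hh : IsPath h) :
    ∃ τ' : ι → ℤ, IsFlip τ τ' ∧ ∀ S : Set ℝ, IsUpperSet S → 0 ∉ S →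
      spinSum τ' ω S = g (spinCount τ ω S) ∧ spinSum τ' p S = h (spinCount τ p S) := by
  classical
  obtain ⟨s, hs, hsS⟩ := exists_sign_of_isPath {i | τ i ≠ 0} ω hg
  obtain ⟨t, ht, htS⟩ := exists_sign_of_isPath {i | τ i ≠ 0} p hh
  simp only [Finset.filter_filter] at hsS htS
  let τ' (i : ι) : ℤ := if τ i = 0 then 0 else if ω i = 0 then t i else s i
  have h0 : ∀ i, τ i = 0 → τ' i = 0 := fun i hi => if_pos hi
  refine ⟨τ', fun i => ?_, fun S hS hS0 => ⟨?_, ?_⟩⟩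
  · have := Int.abs_le_one_iff.mp (hτ i)
    grind
  · rw [spinCount, ← hsS S hS]
    refine spinSum_eq_sum_filter h0 fun i hi hiS => ?_
    have : ω i ≠ 0 := fun h => hS0 (h ▸ hiS)
    simp [τ', hi, this]
  · rw [spinCount, ← htS S hS]
    refine spinSum_eq_sum_filter h0 fun i hi hiS => ?_
    have : ω i = 0 := (hωp i).resolve_right fun h => hS0 (h ▸ hiS)
    simp [τ', hi, this]

end SpinSum

section Layers

open MeasureTheory

/-- The function `f` is integrable on the line with integral `c`. -/
def HasIntegral (f : ℝ → ℝ) (c : ℝ) : Prop := Integrable f ∧ ∫ u, f u = c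

theorem HasIntegral.add {f g : ℝ → ℝ} {c d : ℝ} (hf : HasIntegral f c) (hg : HasIntegral g d) :
    HasIntegral (fun u => f u + g u) (c + d) :=
  ⟨hf.1.add hg.1, by rw [integral_add hf.1 hg.1, hf.2, hg.2]⟩

theorem HasIntegral.const_mul {f : ℝ → ℝ} {c : ℝ} (hf : HasIntegral f c) (a : ℝ) :
    HasIntegral (fun u => a * f u) (a * c) :=
  ⟨hf.1.const_mul a, by rw [integral_const_mul, hf.2]⟩

theorem HasIntegral.sub {f g : ℝ → ℝ} {c d : ℝ} (hf : HasIntegral f c) (hg : HasIntegral g d) :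
    HasIntegral (fun u => f u - g u) (c - d) :=
  ⟨hf.1.sub hg.1, by rw [integral_sub hf.1 hg.1, hf.2, hg.2]⟩

theorem HasIntegral.sum {ι : Type*} (s : Finset ι) {f : ι → ℝ → ℝ} {c : ι → ℝ}
    (hf : ∀ i, HasIntegral (f i) (c i)) : HasIntegral (fun u => ∑ i ∈ s, f i u) (∑ i ∈ s, c i) :=
  ⟨integrable_finsetSum s fun i _ => (hf i).1, by
    rw [integral_finsetSum s fun i _ => (hf i).1]
    exact Finset.sum_congr rfl fun i _ => (hf i).2⟩

theorem HasIntegral.mono {f g : ℝ → ℝ} {c d : ℝ} (hf : HasIntegral f c) (hg : HasIntegral g d)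
    (h : ∀ u, f u ≤ g u) : c ≤ d := by
  rw [← hf.2, ← hg.2]
  exact integral_mono hf.1 hg.1 h

theorem HasIntegral.congr {f g : ℝ → ℝ} {c d : ℝ} (hf : HasIntegral f c) (h : ∀ u, g u = f u)
    (hcd : d = c) : HasIntegral g d := by
  rw [funext h, hcd]
  exact hf

/-- The indicator of the interval `(a, b]`. -/
def cell (a b : ℝ) : ℝ → ℝ := (Set.Ioc a b).indicator 1

theorem cell_eq_zero {a b u : ℝ} (h : u ≤ a ∨ b < u) : cell a b u = 0 :=
  Set.indicator_of_notMem (fun hu => h.elim hu.1.not_ge hu.2.not_gt) _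

theorem cell_eq_one {a b u : ℝ} (ha : a < u) (hb : u ≤ b) : cell a b u = 1 :=
  Set.indicator_of_mem (Set.mem_Ioc.mpr ⟨ha, hb⟩) _

theorem cell_eq_indicator {a b u q : ℝ} {S : Set ℝ} (h : a < u ∧ u ≤ b ↔ q ∈ S) :
    cell a b u = S.indicator (1 : ℝ → ℝ) q := by
  classical
  simp only [cell, Set.indicator_apply, Set.mem_Ioc, h, Pi.one_apply]

theorem hasIntegral_cell (a b : ℝ) : HasIntegral (cell a b) (max (b - a) 0) := by
  refine ⟨(integrable_indicator_iff measurableSet_Ioc).mpr ?_, ?_⟩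
  · exact integrableOn_const (C := (1 : ℝ)) (by simp)
  · rw [cell, integral_indicator_one measurableSet_Ioc, Real.volume_real_Ioc]

theorem hasIntegral_cell_mul (a b c d : ℝ) :
    HasIntegral (fun u => cell a b u * cell c d u) (max (min b d - max a c) 0) := by
  refine (hasIntegral_cell (max a c) (min b d)).congr (fun u => ?_) rfl
  rw [cell, cell, cell, ← Set.Ioc_inter_Ioc, Set.inter_indicator_one, Pi.mul_apply]

variable (δ₁ δ₂ : ℝ)

/-- The heights at which the part below `δ₁` of a KdV-type soliton is recorded; they lie in the
middle layers and are filled from the top. -/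
def lowK (u ω : ℝ) : ℝ := cell (max (δ₂ - ω) (δ₂ - δ₁)) δ₂ u

/-- The heights at which the part between `δ₁` and `2 δ₁` of a KdV-type soliton is recorded; they
lie in the middle layers and are filled from the bottom. -/
def midK (u ω : ℝ) : ℝ := cell (δ₂ - δ₁) (min (δ₂ - 2 * δ₁ + ω) δ₂) u

/-- The heights at which the part above `2 δ₁` of a KdV-type soliton is recorded; they lie in the
high layers and count twice. -/
def highK (u ω : ℝ) : ℝ := cell δ₂ (δ₂ + (ω - 2 * δ₁) / 2) u

/-- The heights in the low layers that a Toda-type soliton occupies. -/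
def lowT (u p : ℝ) : ℝ := cell 0 (min p (δ₂ - δ₁)) u

/-- The heights in the middle layers that a Toda-type soliton occupies. -/
def midT (u p : ℝ) : ℝ := cell (δ₂ - δ₁) (min p δ₂) u

/-- The heights in the high layers that a Toda-type soliton occupies. -/
def highT (u p : ℝ) : ℝ := cell δ₂ p u

/-- The change along `(m, n) = (a, b)` of the phase of a soliton with `Ω = ω` and `P = p`, one of
which is `0`. -/
def field (a b : ℤ) (ω p : ℝ) : ℝ := a * (ω + dispQ δ₂ p) + b * (p + dispK δ₁ ω)

/-- The interaction of solitons with parameters `(ω, p)` and `(ω', p')`. -/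
def coupling (ω p ω' p' : ℝ) : ℝ :=
  interKdV ω ω' + interToda δ₂ p p' + (interMixed δ₁ δ₂ ω p' + interMixed δ₁ δ₂ ω' p)

/-- The contribution of the height `u` to `field`. -/
def layerField (a b : ℤ) (u ω p : ℝ) : ℝ :=
  (a - b) * lowK δ₁ δ₂ u ω + a * midK δ₁ δ₂ u ω + 2 * a * highK δ₁ δ₂ u ω +
    b * lowT δ₁ δ₂ u p + b * midT δ₁ δ₂ u p + (a + b) * highT δ₂ u p

/-- The contribution of the height `u` to `coupling`. -/
def layerCoupling (u ω p ω' p' : ℝ) : ℝ :=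
  -(2 * (lowK δ₁ δ₂ u ω * lowK δ₁ δ₂ u ω') + 2 * (midK δ₁ δ₂ u ω * midK δ₁ δ₂ u ω') +
      4 * (highK δ₁ δ₂ u ω * highK δ₁ δ₂ u ω')) -
    (2 * (midT δ₁ δ₂ u p * midT δ₁ δ₂ u p') + 3 * (highT δ₂ u p * highT δ₂ u p') +
      2 * (lowT δ₁ δ₂ u p * lowT δ₁ δ₂ u p')) +
    ((lowK δ₁ δ₂ u ω * midT δ₁ δ₂ u p' - midK δ₁ δ₂ u ω * midT δ₁ δ₂ u p' -
        2 * (highK δ₁ δ₂ u ω * highT δ₂ u p')) +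
      (lowK δ₁ δ₂ u ω' * midT δ₁ δ₂ u p - midK δ₁ δ₂ u ω' * midT δ₁ δ₂ u p -
        2 * (highK δ₁ δ₂ u ω' * highT δ₂ u p)))

variable {δ₁ δ₂}

theorem dispK_of_nonneg (hδ₁ : 0 ≤ δ₁) {ω : ℝ} (hω : 0 ≤ ω) : dispK δ₁ ω = -min ω δ₁ := by
  rw [dispK]
  grind

theorem dispQ_of_nonneg (hδ₂ : 0 ≤ δ₂) {p : ℝ} (hp : 0 ≤ p) : dispQ δ₂ p = max 0 (p - δ₂) := by
  rw [dispQ]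
  grind

theorem hasIntegral_layerField (hδ₁ : 0 < δ₁) (hδ : δ₁ < δ₂) (a b : ℤ) {ω p : ℝ} (hω : 0 ≤ ω)
    (hp : 0 ≤ p) :
    HasIntegral (fun u => layerField δ₁ δ₂ a b u ω p) (field δ₁ δ₂ a b ω p) := by
  have hlowK := hasIntegral_cell (max (δ₂ - ω) (δ₂ - δ₁)) δ₂
  have hmidK := hasIntegral_cell (δ₂ - δ₁) (min (δ₂ - 2 * δ₁ + ω) δ₂)
  have hhighK := hasIntegral_cell δ₂ (δ₂ + (ω - 2 * δ₁) / 2)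
  have hlowT := hasIntegral_cell 0 (min p (δ₂ - δ₁))
  have hmidT := hasIntegral_cell (δ₂ - δ₁) (min p δ₂)
  have hhighT := hasIntegral_cell δ₂ p
  refine ((((((hlowK.const_mul (a - b)).add (hmidK.const_mul a)).add
    (hhighK.const_mul (2 * a))).add (hlowT.const_mul b)).add (hmidT.const_mul b)).add
    (hhighT.const_mul (a + b))).congr (fun u => rfl) ?_
  have hK := dispK_of_nonneg hδ₁.le hω
  have hQ := dispQ_of_nonneg (hδ₁.trans hδ).le hp
  have elow : max (δ₂ - max (δ₂ - ω) (δ₂ - δ₁)) 0 = -dispK δ₁ ω := by grind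
  have ehigh : max (min (δ₂ - 2 * δ₁ + ω) δ₂ - (δ₂ - δ₁)) 0 +
      2 * max (δ₂ + (ω - 2 * δ₁) / 2 - δ₂) 0 = ω + dispK δ₁ ω := by grind
  have ep : max (min p (δ₂ - δ₁) - 0) 0 + max (min p δ₂ - (δ₂ - δ₁)) 0 + max (p - δ₂) 0 = p := by
    grind
  have eQ : max (p - δ₂) 0 = dispQ δ₂ p := by grind
  rw [field]
  linear_combination (b - a) * elow - a * ehigh - b * ep - a * eQ

theorem hasIntegral_kdv (hδ₁ : 0 < δ₁) {ω ω' : ℝ} (hω : 0 ≤ ω) (hω' : 0 ≤ ω') :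
    HasIntegral (fun u => 2 * (lowK δ₁ δ₂ u ω * lowK δ₁ δ₂ u ω') +
      2 * (midK δ₁ δ₂ u ω * midK δ₁ δ₂ u ω') + 4 * (highK δ₁ δ₂ u ω * highK δ₁ δ₂ u ω'))
      (-interKdV ω ω') := by
  refine ((((hasIntegral_cell_mul _ _ _ _).const_mul 2).add
    ((hasIntegral_cell_mul _ _ _ _).const_mul 2)).add
    ((hasIntegral_cell_mul _ _ _ _).const_mul 4)).congr (fun u => rfl) ?_
  rw [interKdV]
  grind

theorem hasIntegral_toda (hδ₁ : 0 < δ₁) (hδ : δ₁ < δ₂) {p p' : ℝ} (hp : 0 ≤ p) (hp' : 0 ≤ p') :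
    HasIntegral (fun u => 2 * (midT δ₁ δ₂ u p * midT δ₁ δ₂ u p') +
      3 * (highT δ₂ u p * highT δ₂ u p') + 2 * (lowT δ₁ δ₂ u p * lowT δ₁ δ₂ u p'))
      (-interToda δ₂ p p') := by
  refine ((((hasIntegral_cell_mul _ _ _ _).const_mul 2).add
    ((hasIntegral_cell_mul _ _ _ _).const_mul 3)).add
    ((hasIntegral_cell_mul _ _ _ _).const_mul 2)).congr (fun u => rfl) ?_
  have hδ₂ := (hδ₁.trans hδ).le
  rw [interToda, dispQ_of_nonneg hδ₂ hp, dispQ_of_nonneg hδ₂ hp']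
  grind

theorem hasIntegral_mixed (hδ₁ : 0 < δ₁) (hδ : δ₁ < δ₂) {ω p : ℝ} (hω : 0 ≤ ω) (hp : 0 ≤ p) :
    HasIntegral (fun u => lowK δ₁ δ₂ u ω * midT δ₁ δ₂ u p - midK δ₁ δ₂ u ω * midT δ₁ δ₂ u p -
      2 * (highK δ₁ δ₂ u ω * highT δ₂ u p)) (interMixed δ₁ δ₂ ω p) := by
  refine (((hasIntegral_cell_mul _ _ _ _).sub (hasIntegral_cell_mul _ _ _ _)).sub
    ((hasIntegral_cell_mul _ _ _ _).const_mul 2)).congr (fun u => rfl) ?_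
  rcases hω.eq_or_lt with rfl | hω
  · simp only [interMixed, lt_irrefl, false_and, if_false]
    grind
  rcases hp.eq_or_lt with rfl | hp
  · simp only [interMixed, lt_irrefl, and_false, if_false]
    grind
  rw [interMixed, if_pos ⟨hω, hp⟩, dispK_of_nonneg hδ₁.le hω.le,
    dispQ_of_nonneg (hδ₁.trans hδ).le hp.le]
  rcases le_total p δ₂ with h | h <;> rcases le_total ω δ₁ with h' | h' <;> grind (splits := 20)

theorem hasIntegral_layerCoupling (hδ₁ : 0 < δ₁) (hδ : δ₁ < δ₂) {ω p ω' p' : ℝ} (hω : 0 ≤ ω)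
    (hp : 0 ≤ p) (hω' : 0 ≤ ω') (hp' : 0 ≤ p') :
    HasIntegral (fun u => layerCoupling δ₁ δ₂ u ω p ω' p') (coupling δ₁ δ₂ ω p ω' p') := by
  have hkdv := (hasIntegral_kdv (δ₂ := δ₂) hδ₁ hω hω').const_mul (-1)
  have htoda := hasIntegral_toda hδ₁ hδ hp hp'
  have hmixed := (hasIntegral_mixed hδ₁ hδ hω hp').add (hasIntegral_mixed hδ₁ hδ hω' hp)
  refine ((hkdv.sub htoda).add hmixed).congr (fun u => ?_) ?_
  · rw [layerCoupling]
    ring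
  · rw [coupling]
    ring

theorem hasIntegral_spinEnergy {ι : Type*} [Fintype ι] {l : ℝ → ι → ℝ} {l' : ι → ℝ}
    {B : ℝ → ι → ι → ℝ} {B' : ι → ι → ℝ} (hl : ∀ i, HasIntegral (fun u => l u i) (l' i))
    (hB : ∀ i j, HasIntegral (fun u => B u i j) (B' i j)) (τ : ι → ℤ) :
    HasIntegral (fun u => spinEnergy (l u) (B u) τ) (spinEnergy l' B' τ) :=
  ((HasIntegral.sum _ fun i => (hl i).const_mul (τ i)).const_mul 2).add
    (HasIntegral.sum _ fun i => HasIntegral.sum _ fun j => (hB i j).const_mul (τ i * τ j))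

end Layers

section LayerEnergy

/-- The parameter that a KdV-type soliton must reach in order to occupy the height `u > δ₂ - δ₁`
in its part above `δ₁`. -/
def kdvLevel (δ₁ δ₂ u : ℝ) : ℝ := 2 * δ₁ + (u - δ₂) + max (u - δ₂) 0

/-- The energy density above `δ₂` for spin sums `s` (KdV type) and `t` (Toda type). -/
def highDensity (a b s t : ℤ) : ℤ :=
  2 * (2 * a * s + (a + b) * t) - (2 * s ^ 2 + 2 * (s + t) ^ 2 + t ^ 2)

/-- The energy density between `δ₂ - δ₁` and `δ₂` for spin sums `x` (KdV type, part below `δ₁`),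
`y` (KdV type, part above `δ₁`) and `z` (Toda type). -/
def midDensity (a b x y z : ℤ) : ℤ :=
  2 * ((a - b) * x + a * y + b * z) - ((x - z) ^ 2 + (y + z) ^ 2 + x ^ 2 + y ^ 2)

/-- The energy density below `δ₂ - δ₁` for the spin sum `r` (Toda type). -/
def lowDensity (b r : ℤ) : ℤ := 2 * (b * r) - 2 * r ^ 2

variable {ι : Type*} [Fintype ι]

/-- The sum of the values of `f`, weighted by the spins. -/
def weightedSum (τ : ι → ℤ) (f : ι → ℝ) : ℝ := ∑ i, τ i * f i

variable (δ₁ δ₂ : ℝ)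

/-- The energy of a configuration in the field along `(a, b)`. -/
def configEnergy (a b : ℤ) (ω p : ι → ℝ) (τ : ι → ℤ) : ℝ :=
  spinEnergy (fun i => field δ₁ δ₂ a b (ω i) (p i))
    (fun i j => coupling δ₁ δ₂ (ω i) (p i) (ω j) (p j)) τ

/-- The contribution of the height `u` to `configEnergy`. -/
def layerEnergy (a b : ℤ) (ω p : ι → ℝ) (τ : ι → ℤ) (u : ℝ) : ℝ :=
  spinEnergy (fun i => layerField δ₁ δ₂ a b u (ω i) (p i))
    (fun i j => layerCoupling δ₁ δ₂ u (ω i) (p i) (ω j) (p j)) τ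

variable {δ₁ δ₂}

theorem hasIntegral_layerEnergy (hδ₁ : 0 < δ₁) (hδ : δ₁ < δ₂) (a b : ℤ) {ω p : ι → ℝ}
    (hω : ∀ i, 0 ≤ ω i) (hp : ∀ i, 0 ≤ p i) (τ : ι → ℤ) :
    HasIntegral (layerEnergy δ₁ δ₂ a b ω p τ)
      (configEnergy δ₁ δ₂ a b ω p τ) :=
  hasIntegral_spinEnergy (fun i => hasIntegral_layerField hδ₁ hδ a b (hω i) (hp i))
    (fun i j => hasIntegral_layerCoupling hδ₁ hδ (hω i) (hp i) (hω j) (hp j)) τ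

theorem layerEnergy_eq {a b : ℤ} {ω p : ι → ℝ} {τ : ι → ℤ} {u x y s r z t : ℝ}
    (hx : weightedSum τ (fun i => lowK δ₁ δ₂ u (ω i)) = x)
    (hy : weightedSum τ (fun i => midK δ₁ δ₂ u (ω i)) = y)
    (hs : weightedSum τ (fun i => highK δ₁ δ₂ u (ω i)) = s)
    (hr : weightedSum τ (fun i => lowT δ₁ δ₂ u (p i)) = r)
    (hz : weightedSum τ (fun i => midT δ₁ δ₂ u (p i)) = z)
    (ht : weightedSum τ (fun i => highT δ₂ u (p i)) = t) :
    layerEnergy δ₁ δ₂ a b ω p τ u =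
      2 * ((a - b) * x + a * y + 2 * a * s + b * r + b * z + (a + b) * t) -
        ((x - z) ^ 2 + (y + z) ^ 2 + x ^ 2 + y ^ 2 + 2 * s ^ 2 + 2 * (s + t) ^ 2 + t ^ 2 +
          2 * r ^ 2) := by
  have hfield : ∑ i, (τ i : ℝ) * layerField δ₁ δ₂ a b u (ω i) (p i) =
      (a - b) * x + a * y + 2 * a * s + b * r + b * z + (a + b) * t := by
    simp only [← hx, ← hy, ← hs, ← hr, ← hz, ← ht, weightedSum, Finset.mul_sum,
      ← Finset.sum_add_distrib]
    exact Finset.sum_congr rfl fun i _ => by rw [layerField]; ring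
  have hcoupling : ∑ i, ∑ j, (τ i : ℝ) * τ j * layerCoupling δ₁ δ₂ u (ω i) (p i) (ω j) (p j) =
      -(2 * (x * x) + 2 * (y * y) + 4 * (s * s)) - (2 * (z * z) + 3 * (t * t) + 2 * (r * r)) +
        ((x * z - y * z - 2 * (s * t)) + (z * x - z * y - 2 * (t * s))) := by
    simp only [← hx, ← hy, ← hs, ← hr, ← hz, ← ht, weightedSum, Finset.sum_mul_sum]
    simp only [Finset.mul_sum, ← Finset.sum_add_distrib, ← Finset.sum_sub_distrib,
      ← Finset.sum_neg_distrib]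
    exact Finset.sum_congr rfl fun i _ => Finset.sum_congr rfl fun j _ => by
      rw [layerCoupling]; ring
  rw [layerEnergy, spinEnergy, hfield, hcoupling]
  ring

theorem weightedSum_eq_zero (τ : ι → ℤ) {f : ι → ℝ} (hf : ∀ i, f i = 0) : weightedSum τ f = 0 := by
  simp [weightedSum, hf]

theorem weightedSum_eq_spinSum (τ : ι → ℤ) {f q : ι → ℝ} {S : Set ℝ}
    (hf : ∀ i, f i = S.indicator (1 : ℝ → ℝ) (q i)) : weightedSum τ f = spinSum τ q S := by
  simp only [weightedSum, hf, spinSum_cast]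

theorem layerEnergy_of_high (hδ₁ : 0 < δ₁) (a b : ℤ) (ω p : ι → ℝ) (τ : ι → ℤ) {u : ℝ}
    (hu : δ₂ < u) :
    layerEnergy δ₁ δ₂ a b ω p τ u =
      highDensity a b (spinSum τ ω (Set.Ici (kdvLevel δ₁ δ₂ u))) (spinSum τ p (Set.Ici u)) := by
  rw [layerEnergy_eq (weightedSum_eq_zero τ fun i => cell_eq_zero (by grind))
    (weightedSum_eq_zero τ fun i => cell_eq_zero (by grind))
    (weightedSum_eq_spinSum τ fun i => cell_eq_indicator (q := ω i)
      (S := Set.Ici (kdvLevel δ₁ δ₂ u)) (by rw [Set.mem_Ici, kdvLevel]; grind))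
    (weightedSum_eq_zero τ fun i => cell_eq_zero (by grind))
    (weightedSum_eq_zero τ fun i => cell_eq_zero (by grind))
    (weightedSum_eq_spinSum τ fun i => cell_eq_indicator (q := p i) (S := Set.Ici u)
      (by rw [Set.mem_Ici]; grind)), highDensity]
  push_cast
  ring

theorem layerEnergy_of_mid (a b : ℤ) (ω p : ι → ℝ) (τ : ι → ℤ) {u : ℝ}
    (hu : δ₂ - δ₁ < u) (hu' : u ≤ δ₂) :
    layerEnergy δ₁ δ₂ a b ω p τ u =
      midDensity a b (spinSum τ ω (Set.Ioi (δ₂ - u)))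
        (spinSum τ ω (Set.Ici (kdvLevel δ₁ δ₂ u))) (spinSum τ p (Set.Ici u)) := by
  rw [layerEnergy_eq
    (weightedSum_eq_spinSum τ fun i => cell_eq_indicator (q := ω i) (S := Set.Ioi (δ₂ - u))
      (by rw [Set.mem_Ioi]; grind))
    (weightedSum_eq_spinSum τ fun i => cell_eq_indicator (q := ω i)
      (S := Set.Ici (kdvLevel δ₁ δ₂ u)) (by rw [Set.mem_Ici, kdvLevel]; grind))
    (weightedSum_eq_zero τ fun i => cell_eq_zero (by grind))
    (weightedSum_eq_zero τ fun i => cell_eq_zero (by grind))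
    (weightedSum_eq_spinSum τ fun i => cell_eq_indicator (q := p i) (S := Set.Ici u)
      (by rw [Set.mem_Ici]; grind))
    (weightedSum_eq_zero τ fun i => cell_eq_zero (by grind)), midDensity]
  push_cast
  ring

theorem layerEnergy_of_low (hδ₁ : 0 < δ₁) (a b : ℤ) (ω p : ι → ℝ) (τ : ι → ℤ) {u : ℝ}
    (hu : 0 < u) (hu' : u ≤ δ₂ - δ₁) :
    layerEnergy δ₁ δ₂ a b ω p τ u = lowDensity b (spinSum τ p (Set.Ici u)) := by
  rw [layerEnergy_eq (weightedSum_eq_zero τ fun i => cell_eq_zero (by grind))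
    (weightedSum_eq_zero τ fun i => cell_eq_zero (by grind))
    (weightedSum_eq_zero τ fun i => cell_eq_zero (by grind))
    (weightedSum_eq_spinSum τ fun i => cell_eq_indicator (q := p i) (S := Set.Ici u)
      (by rw [Set.mem_Ici]; grind))
    (weightedSum_eq_zero τ fun i => cell_eq_zero (by grind))
    (weightedSum_eq_zero τ fun i => cell_eq_zero (by grind)), lowDensity]
  push_cast
  ring

theorem layerEnergy_of_nonpos (hδ₁ : 0 < δ₁) (hδ : δ₁ < δ₂) (a b : ℤ) (ω p : ι → ℝ) (τ : ι → ℤ)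
    {u : ℝ} (hu : u ≤ 0) : layerEnergy δ₁ δ₂ a b ω p τ u = 0 := by
  rw [layerEnergy_eq (weightedSum_eq_zero τ fun i => cell_eq_zero (by grind))
    (weightedSum_eq_zero τ fun i => cell_eq_zero (by grind))
    (weightedSum_eq_zero τ fun i => cell_eq_zero (by grind))
    (weightedSum_eq_zero τ fun i => cell_eq_zero (by grind))
    (weightedSum_eq_zero τ fun i => cell_eq_zero (by grind))
    (weightedSum_eq_zero τ fun i => cell_eq_zero (by grind))]
  ring

theorem configEnergy_le (hδ₁ : 0 < δ₁) (hδ : δ₁ < δ₂) {ω p : ι → ℝ} (hω : ∀ i, 0 ≤ ω i)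
    (hp : ∀ i, 0 ≤ p i) {a b a' b' k k' : ℤ} {τ τ' : ι → ℤ}
    (hhigh : ∀ u, δ₂ < u →
      highDensity a b (spinSum τ ω (Set.Ici (kdvLevel δ₁ δ₂ u))) (spinSum τ p (Set.Ici u)) ≤
      highDensity a' b' (spinSum τ' ω (Set.Ici (kdvLevel δ₁ δ₂ u))) (spinSum τ' p (Set.Ici u)))
    (hmid : ∀ u, δ₂ - δ₁ < u → u ≤ δ₂ →
      midDensity a b (spinSum τ ω (Set.Ioi (δ₂ - u)))
        (spinSum τ ω (Set.Ici (kdvLevel δ₁ δ₂ u))) (spinSum τ p (Set.Ici u)) ≤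
      midDensity a' b' (spinSum τ' ω (Set.Ioi (δ₂ - u)))
        (spinSum τ' ω (Set.Ici (kdvLevel δ₁ δ₂ u))) (spinSum τ' p (Set.Ici u)) + k)
    (hlow : ∀ u, 0 < u → u ≤ δ₂ - δ₁ →
      lowDensity b (spinSum τ p (Set.Ici u)) ≤ lowDensity b' (spinSum τ' p (Set.Ici u)) + k') :
    configEnergy δ₁ δ₂ a b ω p τ ≤
      configEnergy δ₁ δ₂ a' b' ω p τ' + (k * δ₁ + k' * (δ₂ - δ₁)) := by
  have hk := (hasIntegral_cell (δ₂ - δ₁) δ₂).const_mul k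
  have hk' := (hasIntegral_cell 0 (δ₂ - δ₁)).const_mul k'
  rw [show max (δ₂ - (δ₂ - δ₁)) 0 = δ₁ by grind] at hk
  rw [show max (δ₂ - δ₁ - 0) 0 = δ₂ - δ₁ by grind] at hk'
  refine (hasIntegral_layerEnergy hδ₁ hδ a b hω hp τ).mono
    ((hasIntegral_layerEnergy hδ₁ hδ a' b' hω hp τ').add (hk.add hk')) fun u => ?_
  rcases le_or_gt u 0 with h0 | h0
  · rw [layerEnergy_of_nonpos hδ₁ hδ _ _ _ _ _ h0, layerEnergy_of_nonpos hδ₁ hδ _ _ _ _ _ h0,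
      cell_eq_zero (.inl (h0.trans (sub_nonneg.mpr hδ.le))), cell_eq_zero (.inl h0)]
    simp
  rcases le_or_gt u (δ₂ - δ₁) with h1 | h1
  · rw [layerEnergy_of_low hδ₁ _ _ _ _ _ h0 h1, layerEnergy_of_low hδ₁ _ _ _ _ _ h0 h1,
      cell_eq_zero (.inl h1), cell_eq_one h0 h1]
    exact_mod_cast (hlow u h0 h1).trans_eq (by ring)
  rcases le_or_gt u δ₂ with h2 | h2
  · rw [layerEnergy_of_mid _ _ _ _ _ h1 h2, layerEnergy_of_mid _ _ _ _ _ h1 h2,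
      cell_eq_one h1 h2, cell_eq_zero (.inr h1)]
    exact_mod_cast (hmid u h1 h2).trans_eq (by ring)
  · rw [layerEnergy_of_high hδ₁ _ _ _ _ _ h2, layerEnergy_of_high hδ₁ _ _ _ _ _ h2,
      cell_eq_zero (.inr h2), cell_eq_zero (.inr ((sub_lt_self δ₂ hδ₁).trans h2))]
    exact_mod_cast (hhigh u h2).trans_eq (by ring)

end LayerEnergy

section Densities

theorem sq_le_sq_of_emod_two_eq {v w : ℤ} (h : v % 2 = w % 2) (hv : -1 ≤ v ∧ v ≤ 1) :
    v ^ 2 ≤ w ^ 2 := by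
  rcases eq_or_ne w 0 with rfl | hw
  · obtain rfl : v = 0 := by omega
    rfl
  · exact sq_le_sq.mpr ((abs_le.mpr hv).trans (Int.one_le_abs hw))

theorem highDensity_two_one_le (s t : ℤ) :
    highDensity 2 1 s t ≤ highDensity 2 1 (s % 2) (t % 2) := by
  have hs : (s % 2 - 1) ^ 2 ≤ (s - 1) ^ 2 := sq_le_sq_of_emod_two_eq (by omega) (by omega)
  have hst : (s % 2 + t % 2 - 1) ^ 2 ≤ (s + t - 1) ^ 2 :=
    sq_le_sq_of_emod_two_eq (by omega) (by omega)
  have ht : (t % 2 - 1) ^ 2 ≤ (t - 1) ^ 2 := sq_le_sq_of_emod_two_eq (by omega) (by omega)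
  simp only [highDensity]
  linarith

theorem highDensity_zero_one_le (s t : ℤ) :
    highDensity 0 1 s t ≤ highDensity 2 1 (s % 2) (t % 2) := by
  have hs := sq_nonneg s
  have hst := sq_nonneg (s + t)
  have ht : (t % 2 - 1) ^ 2 ≤ (t - 1) ^ 2 := sq_le_sq_of_emod_two_eq (by omega) (by omega)
  simp only [highDensity]
  rcases Int.emod_two_eq_zero_or_one s with h | h <;>
    rcases Int.emod_two_eq_zero_or_one t with h' | h' <;> rw [h'] at ht <;> rw [h, h'] <;> linarith

theorem highDensity_two_neg_one_le (s t : ℤ) :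
    highDensity 2 (-1) s t ≤ highDensity 2 1 (s % 2) (t % 2) := by
  have hs : (s % 2 - 1) ^ 2 ≤ (s - 1) ^ 2 := sq_le_sq_of_emod_two_eq (by omega) (by omega)
  have hst : (s % 2 + t % 2 - 1) ^ 2 ≤ (s + t - 1) ^ 2 :=
    sq_le_sq_of_emod_two_eq (by omega) (by omega)
  have ht : (t % 2 - 1) ^ 2 ≤ (t + 1) ^ 2 := sq_le_sq_of_emod_two_eq (by omega) (by omega)
  simp only [highDensity]
  linarith

theorem highDensity_zero_three_le (s t : ℤ) :
    highDensity 0 3 s t ≤ highDensity 2 1 (s % 2) (t % 2) := by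
  have hs : (s % 2 - 1) ^ 2 ≤ (s + 1) ^ 2 := sq_le_sq_of_emod_two_eq (by omega) (by omega)
  have hst : (s % 2 + t % 2 - 1) ^ 2 ≤ (s + t - 1) ^ 2 :=
    sq_le_sq_of_emod_two_eq (by omega) (by omega)
  have ht : (t % 2 - 1) ^ 2 ≤ (t - 1) ^ 2 := sq_le_sq_of_emod_two_eq (by omega) (by omega)
  simp only [highDensity]
  linarith

theorem midDensity_two_one_le (x y z : ℤ) :
    midDensity 2 1 x y z ≤ midDensity 2 1 (x % 2) (y % 2) (z % 2) := by
  have hxz : (x % 2 - z % 2) ^ 2 ≤ (x - z) ^ 2 := sq_le_sq_of_emod_two_eq (by omega) (by omega)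
  have hyz : (y % 2 + z % 2 - 1) ^ 2 ≤ (y + z - 1) ^ 2 :=
    sq_le_sq_of_emod_two_eq (by omega) (by omega)
  have hx : (x % 2 - 1) ^ 2 ≤ (x - 1) ^ 2 := sq_le_sq_of_emod_two_eq (by omega) (by omega)
  have hy : (y % 2 - 1) ^ 2 ≤ (y - 1) ^ 2 := sq_le_sq_of_emod_two_eq (by omega) (by omega)
  simp only [midDensity]
  linarith

theorem midDensity_zero_one_le (x y z : ℤ) :
    midDensity 0 1 x y z ≤ midDensity 2 1 (x % 2) (y % 2) (z % 2) := by
  have hxz : ((x - z + 1) % 2) ^ 2 ≤ (x - z + 1) ^ 2 :=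
    sq_le_sq_of_emod_two_eq (by omega) (by omega)
  have hyz : ((y + z) % 2) ^ 2 ≤ (y + z) ^ 2 := sq_le_sq_of_emod_two_eq (by omega) (by omega)
  have hx : (x % 2) ^ 2 ≤ x ^ 2 := sq_le_sq_of_emod_two_eq (by omega) (by omega)
  have hy : (y % 2) ^ 2 ≤ y ^ 2 := sq_le_sq_of_emod_two_eq (by omega) (by omega)
  have hresidues : 1 - ((x - z + 1) % 2) ^ 2 - ((y + z) % 2) ^ 2 - (x % 2) ^ 2 - (y % 2) ^ 2 ≤
      midDensity 2 1 (x % 2) (y % 2) (z % 2) := by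
    rw [show (x - z + 1) % 2 = (x % 2 + z % 2 + 1) % 2 by omega, Int.add_emod y z]
    rcases Int.emod_two_eq_zero_or_one x with h | h <;>
      rcases Int.emod_two_eq_zero_or_one y with h' | h' <;>
      rcases Int.emod_two_eq_zero_or_one z with h'' | h'' <;> rw [h, h', h''] <;> decide
  refine le_trans ?_ hresidues
  rw [midDensity]
  linarith

theorem midDensity_two_neg_one_le (x y z : ℤ) :
    midDensity 2 (-1) x y z ≤ midDensity 2 1 (x % 2) (y % 2) (z % 2) + 4 := by
  have hxz : (x % 2 - z % 2) ^ 2 ≤ (x - z - 2) ^ 2 := sq_le_sq_of_emod_two_eq (by omega) (by omega)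
  have hyz : (y % 2 + z % 2 - 1) ^ 2 ≤ (y + z - 1) ^ 2 :=
    sq_le_sq_of_emod_two_eq (by omega) (by omega)
  have hx : (x % 2 - 1) ^ 2 ≤ (x - 1) ^ 2 := sq_le_sq_of_emod_two_eq (by omega) (by omega)
  have hy : (y % 2 - 1) ^ 2 ≤ (y - 1) ^ 2 := sq_le_sq_of_emod_two_eq (by omega) (by omega)
  simp only [midDensity]
  linarith

theorem midDensity_zero_three_le (x y z : ℤ) :
    midDensity 0 3 x y z ≤ midDensity 2 1 (x % 2) (y % 2) (z % 2) + 4 := by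
  have hxz : (x % 2 - z % 2) ^ 2 ≤ (x - z + 2) ^ 2 := sq_le_sq_of_emod_two_eq (by omega) (by omega)
  have hyz : (y % 2 + z % 2 - 1) ^ 2 ≤ (y + z - 1) ^ 2 :=
    sq_le_sq_of_emod_two_eq (by omega) (by omega)
  have hx : (x % 2 - 1) ^ 2 ≤ (x + 1) ^ 2 := sq_le_sq_of_emod_two_eq (by omega) (by omega)
  have hy : (y % 2 - 1) ^ 2 ≤ (y + 1) ^ 2 := sq_le_sq_of_emod_two_eq (by omega) (by omega)
  simp only [midDensity]
  linarith

theorem lowDensity_one_nonpos (r : ℤ) : lowDensity 1 r ≤ 0 := by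
  have hr := Int.le_self_sq r
  rw [lowDensity]
  linarith

theorem lowDensity_neg_one_nonpos (r : ℤ) : lowDensity (-1) r ≤ 0 := by
  have hr := Int.le_self_sq (-r)
  rw [lowDensity]
  linarith

theorem lowDensity_three_le (r : ℤ) : lowDensity 3 r ≤ 4 := by
  have hr := Int.le_self_sq (r - 1)
  rw [lowDensity]
  linarith

theorem lowDensity_zero (b : ℤ) : lowDensity b 0 = 0 := by
  rw [lowDensity]
  ring

theorem parity_eq (n : ℕ) : Even n ∧ parity n = 0 ∨ Odd n ∧ parity n = 1 := by
  rw [parity, Nat.even_iff, Nat.odd_iff]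
  omega

theorem lowDensity_one_emod_two (r : ℤ) : lowDensity 1 (r % 2) = 0 := by
  rcases Int.emod_two_eq_zero_or_one r with h | h <;> rw [h] <;> rfl

theorem lowDensity_neg_one_neg_parity (n : ℕ) : lowDensity (-1) (-parity n) = 0 := by
  rcases parity_eq n with ⟨-, h⟩ | ⟨-, h⟩ <;> rw [h] <;> rfl

theorem lowDensity_three_two_sub_parity (n : ℕ) : lowDensity 3 (2 - parity n) = 4 := by
  rcases parity_eq n with ⟨-, h⟩ | ⟨-, h⟩ <;> rw [h] <;> rfl

/-- The parities of the numbers of nonzero spins at a height above `δ₂`, for the KdV and the Toda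
type, for which the maximal energy densities along `(2, 1)` and `(0, 1)` differ. -/
def IsExceptionalHigh (s t : ℕ) : Prop := Odd s ∨ Odd t

/-- The parities of the numbers of nonzero spins at a height between `δ₂ - δ₁` and `δ₂`, for the
two parts of the KdV type and the Toda type, for which the maximal energy densities along `(2, 1)`
and `(0, 1)` differ. -/
def IsExceptionalMid (x y z : ℕ) : Prop := Odd x ∧ Odd z ∨ Odd y ∧ Even z

theorem highDensity_eq_two_neg_one (s t : ℕ) :
    highDensity 2 1 (parity s) (parity t) = highDensity 2 (-1) (2 - parity s) (-parity t) := by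
  rcases parity_eq s with ⟨-, hs⟩ | ⟨-, hs⟩ <;> rcases parity_eq t with ⟨-, ht⟩ | ⟨-, ht⟩ <;>
    rw [hs, ht] <;> decide

theorem highDensity_eq_zero_three (s t : ℕ) :
    highDensity 2 1 (parity s) (parity t) = highDensity 0 3 (-parity s) (2 - parity t) := by
  rcases parity_eq s with ⟨-, hs⟩ | ⟨-, hs⟩ <;> rcases parity_eq t with ⟨-, ht⟩ | ⟨-, ht⟩ <;>
    rw [hs, ht] <;> decide

theorem midDensity_eq_two_neg_one (x y z : ℕ) :
    midDensity 2 1 (parity x) (parity y) (parity z) + 4 =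
      midDensity 2 (-1) (2 - parity x) (2 - parity y) (-parity z) := by
  rcases parity_eq x with ⟨-, hx⟩ | ⟨-, hx⟩ <;> rcases parity_eq y with ⟨-, hy⟩ | ⟨-, hy⟩ <;>
    rcases parity_eq z with ⟨-, hz⟩ | ⟨-, hz⟩ <;> rw [hx, hy, hz] <;> decide

theorem midDensity_eq_zero_three (x y z : ℕ) :
    midDensity 2 1 (parity x) (parity y) (parity z) + 4 =
      midDensity 0 3 (-parity x) (-parity y) (2 - parity z) := by
  rcases parity_eq x with ⟨-, hx⟩ | ⟨-, hx⟩ <;> rcases parity_eq y with ⟨-, hy⟩ | ⟨-, hy⟩ <;>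
    rcases parity_eq z with ⟨-, hz⟩ | ⟨-, hz⟩ <;> rw [hx, hy, hz] <;> decide

theorem parity_eq_zero_of_not_isExceptionalHigh {s t : ℕ}
    (h : ¬IsExceptionalHigh s t) : parity s = 0 ∧ parity t = 0 := by
  unfold IsExceptionalHigh at h
  have hs := parity_eq s
  have ht := parity_eq t
  tauto

section NotExceptional

variable {x y z : ℕ} (h : ¬IsExceptionalMid x y z)
include h

theorem midDensity_zero_one_of_not_isExceptionalMid :
    midDensity 2 1 (parity x) (parity y) (parity z) =
      midDensity 0 1 (-parity x) (-parity y) (parity z) := by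
  unfold IsExceptionalMid at h
  rcases parity_eq x with ⟨hx, hx'⟩ | ⟨hx, hx'⟩ <;>
    rcases parity_eq y with ⟨hy, hy'⟩ | ⟨hy, hy'⟩ <;>
    rcases parity_eq z with ⟨hz, hz'⟩ | ⟨hz, hz'⟩ <;> first | tauto | (rw [hx', hy', hz']; decide)

theorem midDensity_two_neg_one_of_not_isExceptionalMid :
    midDensity 2 1 (parity x) (parity y) (parity z) + 4 =
      midDensity 2 (-1) (2 - parity x) (parity y) (parity z) := by
  unfold IsExceptionalMid at h
  rcases parity_eq x with ⟨hx, hx'⟩ | ⟨hx, hx'⟩ <;>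
    rcases parity_eq y with ⟨hy, hy'⟩ | ⟨hy, hy'⟩ <;>
    rcases parity_eq z with ⟨hz, hz'⟩ | ⟨hz, hz'⟩ <;> first | tauto | (rw [hx', hy', hz']; decide)

theorem midDensity_zero_three_of_not_isExceptionalMid :
    midDensity 2 1 (parity x) (parity y) (parity z) + 4 =
      midDensity 0 3 (-(2 - parity x)) (-parity y) (parity z) := by
  unfold IsExceptionalMid at h
  rcases parity_eq x with ⟨hx, hx'⟩ | ⟨hx, hx'⟩ <;>
    rcases parity_eq y with ⟨hy, hy'⟩ | ⟨hy, hy'⟩ <;>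
    rcases parity_eq z with ⟨hz, hz'⟩ | ⟨hz, hz'⟩ <;> first | tauto | (rw [hx', hy', hz']; decide)

end NotExceptional

theorem kdv_highDensity_zero_three_le (s : ℤ) :
    highDensity 0 3 s 0 ≤ highDensity 0 (-1) (s % 2) 0 := by
  have hs : (s % 2) ^ 2 ≤ s ^ 2 := sq_le_sq_of_emod_two_eq (by omega) (by omega)
  simp only [highDensity]
  linarith

theorem kdv_highDensity_one_le (s b b' : ℤ) :
    highDensity 1 b s 0 ≤ highDensity 1 b' (s % 2) 0 := by
  have hs := Int.le_self_sq s
  simp only [highDensity]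
  rcases Int.emod_two_eq_zero_or_one s with h | h <;> rw [h] <;> linarith

theorem kdv_midDensity_zero_three_le (x y : ℤ) :
    midDensity 0 3 x y 0 ≤ midDensity 0 (-1) (x % 2) (y % 2) 0 + 4 := by
  have hx := Int.le_self_sq (x + 2)
  have hy : (y % 2) ^ 2 ≤ y ^ 2 := sq_le_sq_of_emod_two_eq (by omega) (by omega)
  simp only [midDensity]
  rcases Int.emod_two_eq_zero_or_one x with h | h <;> rw [h] <;> linarith

theorem kdv_midDensity_one_one_le (x y : ℤ) :
    midDensity 1 1 x y 0 ≤ midDensity 1 (-1) (x % 2) (y % 2) 0 := by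
  have hx := sq_nonneg x
  have hy := Int.le_self_sq y
  simp only [midDensity]
  rcases Int.emod_two_eq_zero_or_one x with h | h <;>
    rcases Int.emod_two_eq_zero_or_one y with h' | h' <;> rw [h, h'] <;> linarith

theorem kdv_midDensity_one_neg_one_le (x y : ℤ) :
    midDensity 1 (-1) x y 0 ≤ midDensity 1 1 (x % 2) (y % 2) 0 + 4 := by
  have hx := sq_nonneg (x - 1)
  have hy := Int.le_self_sq y
  simp only [midDensity]
  rcases Int.emod_two_eq_zero_or_one x with h | h <;>
    rcases Int.emod_two_eq_zero_or_one y with h' | h' <;> rw [h, h'] <;> linarith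

end Densities

section LeftLimits

open Filter Topology

variable {α : Type*} [TopologicalSpace α]

theorem exists_isGreatest_of_eventually [ConditionallyCompleteLinearOrder α] [OrderTopology α]
    {K : Set α} (hne : K.Nonempty) (hbdd : BddAbove K)
    (hK : ∀ v, ∀ᶠ u in 𝓝[≤] v, u ∈ K → v ∈ K) : ∃ v, IsGreatest K v := by
  have hlub := isLUB_csSup hne hbdd
  obtain ⟨u, hu, h⟩ := ((hlub.frequently_mem hne).and_eventually (hK _)).exists
  exact ⟨sSup K, h hu, hlub.1⟩

theorem eventually_mem_iff_of_isOpen_of_isUpperSet [Preorder α] {A : Set α} (hA : IsOpen A)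
    (hA' : IsUpperSet A) (v : α) : ∀ᶠ u in 𝓝[≤] v, u ∈ A ↔ v ∈ A := by
  by_cases hv : v ∈ A
  · filter_upwards [mem_nhdsWithin_of_mem_nhds (hA.mem_nhds hv)] with u hu
    exact iff_of_true hu hv
  · filter_upwards [self_mem_nhdsWithin] with u hu
    exact iff_of_false (fun h => hv (hA' hu h)) hv

theorem eventually_lt_iff (c v : ℝ) : ∀ᶠ u in 𝓝[≤] v, c < u ↔ c < v :=
  eventually_mem_iff_of_isOpen_of_isUpperSet isOpen_Ioi (isUpperSet_Ioi c) v

theorem eventually_mem_Ici_iff {f : ℝ → ℝ} (hf : Monotone f) (hf' : Continuous f) (v x : ℝ) :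
    ∀ᶠ u in 𝓝[≤] v, x ∈ Set.Ici (f u) ↔ x ∈ Set.Ici (f v) := by
  filter_upwards [eventually_mem_iff_of_isOpen_of_isUpperSet (isOpen_Ioi.preimage hf')
    ((isUpperSet_Ioi x).preimage hf) v] with u hu
  simpa only [Set.mem_preimage, Set.mem_Ioi, Set.mem_Ici, not_lt] using not_congr hu

theorem eventually_mem_Ioi_sub_iff (c v x : ℝ) :
    ∀ᶠ u in 𝓝[≤] v, x ∈ Set.Ioi (c - u) ↔ x ∈ Set.Ioi (c - v) := by
  filter_upwards [eventually_lt_iff (c - x) v] with u hu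
  simpa only [Set.mem_Ioi, sub_lt_comm] using hu

end LeftLimits

section Counts

open Filter Topology

theorem kdvLevel_mono (δ₁ δ₂ : ℝ) : Monotone (kdvLevel δ₁ δ₂) := by
  intro u v h
  unfold kdvLevel
  gcongr

theorem continuous_kdvLevel (δ₁ δ₂ : ℝ) : Continuous (kdvLevel δ₁ δ₂) := by
  unfold kdvLevel
  fun_prop

theorem lt_kdvLevel {δ₁ δ₂ u : ℝ} (hu : δ₂ - δ₁ < u) : δ₁ < kdvLevel δ₁ δ₂ u := by
  rw [kdvLevel]
  linarith [le_max_right (u - δ₂) 0]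

variable {ι : Type*} [Fintype ι] (δ₁ δ₂ : ℝ) (ω p : ι → ℝ) (τ : ι → ℤ)

/-- The number of nonzero spins of KdV type that occupy the height `u ≤ δ₂` in their part below
`δ₁`. -/
def kdvCountBelow (u : ℝ) : ℕ := spinCount τ ω (Set.Ioi (δ₂ - u))

/-- The number of nonzero spins of KdV type that occupy the height `u > δ₂ - δ₁` in their part
above `δ₁`. -/
def kdvCountAbove (u : ℝ) : ℕ := spinCount τ ω (Set.Ici (kdvLevel δ₁ δ₂ u))

/-- The number of nonzero spins of Toda type that occupy the height `u > 0`. -/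
def todaCount (u : ℝ) : ℕ := spinCount τ p (Set.Ici u)

/-- At the height `u` the maximal energy densities along `(2, 1)` and `(0, 1)` differ. -/
def IsExceptional (u : ℝ) : Prop :=
  δ₂ < u ∧ IsExceptionalHigh (kdvCountAbove δ₁ δ₂ ω τ u) (todaCount p τ u) ∨
    (δ₂ - δ₁ < u ∧ u ≤ δ₂) ∧
      IsExceptionalMid (kdvCountBelow δ₂ ω τ u) (kdvCountAbove δ₁ δ₂ ω τ u) (todaCount p τ u)

theorem kdvCountBelow_mono : Monotone (kdvCountBelow δ₂ ω τ) := fun _ _ h =>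
  spinCount_mono τ ω (Set.Ioi_subset_Ioi (sub_le_sub_left h δ₂))

theorem kdvCountAbove_anti : Antitone (kdvCountAbove δ₁ δ₂ ω τ) := fun _ _ h =>
  spinCount_mono τ ω (Set.Ici_subset_Ici.mpr (kdvLevel_mono δ₁ δ₂ h))

theorem todaCount_anti : Antitone (todaCount p τ) := fun _ _ h =>
  spinCount_mono τ p (Set.Ici_subset_Ici.mpr h)

variable {δ₁ δ₂}

theorem kdvCountAbove_le_kdvCountBelow {u v : ℝ} (hu : δ₂ - δ₁ < u) (hv : δ₂ - δ₁ < v) :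
    kdvCountAbove δ₁ δ₂ ω τ v ≤ kdvCountBelow δ₂ ω τ u :=
  spinCount_mono τ ω (Set.Ici_subset_Ioi.mpr ((sub_lt_comm.mp hu).trans (lt_kdvLevel hv)))

variable {ω p} in
theorem eventually_spinCount_eq {α : Type*} {l : Filter α} {S : α → Set ℝ} {S' : Set ℝ}
    (h : ∀ x, ∀ᶠ u in l, x ∈ S u ↔ x ∈ S') :
    ∀ᶠ u in l, spinCount τ ω (S u) = spinCount τ ω S' :=
  (eventually_all.mpr fun i => h (ω i)).mono fun _ hu => spinCount_congr τ ω hu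

theorem eventually_isExceptional_iff (v : ℝ) : ∀ᶠ u in 𝓝[≤] v,
    IsExceptional δ₁ δ₂ ω p τ u ↔ IsExceptional δ₁ δ₂ ω p τ v := by
  have hbelow : ∀ᶠ u in 𝓝[≤] v, kdvCountBelow δ₂ ω τ u = kdvCountBelow δ₂ ω τ v :=
    eventually_spinCount_eq τ (eventually_mem_Ioi_sub_iff δ₂ v)
  have habove : ∀ᶠ u in 𝓝[≤] v, kdvCountAbove δ₁ δ₂ ω τ u = kdvCountAbove δ₁ δ₂ ω τ v :=
    eventually_spinCount_eq τ
      (eventually_mem_Ici_iff (kdvLevel_mono δ₁ δ₂) (continuous_kdvLevel δ₁ δ₂) v)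
  have htoda : ∀ᶠ u in 𝓝[≤] v, todaCount p τ u = todaCount p τ v :=
    eventually_spinCount_eq τ (eventually_mem_Ici_iff monotone_id continuous_id v)
  filter_upwards [eventually_lt_iff δ₂ v, eventually_lt_iff (δ₂ - δ₁) v, hbelow, habove, htoda]
    with u hhigh hmid hbelow habove htoda
  simp only [IsExceptional, ← not_lt, hhigh, hmid, hbelow, habove, htoda]

theorem eventually_not_isExceptional : ∀ᶠ u in atTop, ¬IsExceptional δ₁ δ₂ ω p τ u := by
  filter_upwards [eventually_gt_atTop δ₂, eventually_all.mpr fun i => eventually_gt_atTop (p i),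
    eventually_all.mpr fun i => eventually_gt_atTop (ω i + δ₂ - 2 * δ₁)] with u hu hp hω
  have habove : kdvCountAbove δ₁ δ₂ ω τ u = 0 := spinCount_eq_zero τ fun i hi => by
    have := Set.mem_Ici.mp hi
    rw [kdvLevel] at this
    linarith [hω i, le_max_right (u - δ₂) 0]
  have htoda : todaCount p τ u = 0 := spinCount_eq_zero τ fun i => (hp i).not_ge
  rintro (⟨-, h⟩ | ⟨⟨-, h⟩, -⟩)
  · simp [IsExceptionalHigh, habove, htoda] at h
  · exact h.not_gt hu

theorem exists_isGreatest_isExceptional (h : ∃ u, IsExceptional δ₁ δ₂ ω p τ u) :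
    ∃ v, IsGreatest {u | IsExceptional δ₁ δ₂ ω p τ u} v := by
  obtain ⟨b, hb⟩ := eventually_atTop.mp (eventually_not_isExceptional (δ₁ := δ₁) (δ₂ := δ₂) ω p τ)
  refine exists_isGreatest_of_eventually h ⟨b, fun u hu => ?_⟩ fun v =>
    (eventually_isExceptional_iff ω p τ v).mono fun _ => Iff.mp
  exact not_lt.mp fun hbu => hb u hbu.le hu

end Counts

section Moves

/-- Moduli `ω` of KdV type and `p` of Toda type, of which each soliton has at most one nonzero
value. -/
structure IsModuli {ι : Type*} (ω p : ι → ℝ) : Prop where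
  kdv_nonneg : ∀ i, 0 ≤ ω i
  toda_nonneg : ∀ i, 0 ≤ p i
  eq_zero_or_eq_zero : ∀ i, ω i = 0 ∨ p i = 0

variable {ι : Type*} [Fintype ι] {δ₁ δ₂ : ℝ} {ω p : ι → ℝ} {τ : ι → ℤ} {a b a' b' k k' : ℤ}
  {g h : ℕ → ℤ}

theorem exists_isFlip_configEnergy_le (hδ₁ : 0 < δ₁) (hδ : δ₁ < δ₂) (hωp : IsModuli ω p)
    (hτ : ∀ i, |τ i| ≤ 1) (hg : IsPath g) (hh : IsPath h)
    (hhigh : ∀ u, δ₂ < u →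
      highDensity a b (spinSum τ ω (Set.Ici (kdvLevel δ₁ δ₂ u))) (spinSum τ p (Set.Ici u)) ≤
      highDensity a' b' (g (kdvCountAbove δ₁ δ₂ ω τ u)) (h (todaCount p τ u)))
    (hmid : ∀ u, δ₂ - δ₁ < u → u ≤ δ₂ →
      midDensity a b (spinSum τ ω (Set.Ioi (δ₂ - u)))
        (spinSum τ ω (Set.Ici (kdvLevel δ₁ δ₂ u))) (spinSum τ p (Set.Ici u)) ≤
      midDensity a' b' (g (kdvCountBelow δ₂ ω τ u)) (g (kdvCountAbove δ₁ δ₂ ω τ u))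
        (h (todaCount p τ u)) + k)
    (hlow : ∀ u, 0 < u → u ≤ δ₂ - δ₁ →
      lowDensity b (spinSum τ p (Set.Ici u)) ≤ lowDensity b' (h (todaCount p τ u)) + k') :
    ∃ τ', IsFlip τ τ' ∧ configEnergy δ₁ δ₂ a b ω p τ ≤
      configEnergy δ₁ δ₂ a' b' ω p τ' + (k * δ₁ + k' * (δ₂ - δ₁)) := by
  obtain ⟨τ', hττ', hsum⟩ := exists_isFlip_spinSum_eq hτ hωp.eq_zero_or_eq_zero hg hh
  have hbelow : ∀ u ≤ δ₂, spinSum τ' ω (Set.Ioi (δ₂ - u)) = g (kdvCountBelow δ₂ ω τ u) :=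
    fun u hu => (hsum _ (isUpperSet_Ioi _) (sub_nonneg.mpr hu).not_gt).1
  have habove : ∀ u, δ₂ - δ₁ < u →
      spinSum τ' ω (Set.Ici (kdvLevel δ₁ δ₂ u)) = g (kdvCountAbove δ₁ δ₂ ω τ u) := fun u hu =>
    (hsum _ (isUpperSet_Ici _) (hδ₁.trans (lt_kdvLevel hu)).not_ge).1
  have htoda : ∀ u, 0 < u → spinSum τ' p (Set.Ici u) = h (todaCount p τ u) :=
    fun u hu => (hsum _ (isUpperSet_Ici _) hu.not_ge).2
  have hpos : ∀ {u}, δ₂ - δ₁ < u → 0 < u := (sub_pos.mpr hδ).trans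
  have hmid_of_high : ∀ {u}, δ₂ < u → δ₂ - δ₁ < u := (sub_lt_self δ₂ hδ₁).trans
  refine ⟨τ', hττ', configEnergy_le hδ₁ hδ hωp.kdv_nonneg hωp.toda_nonneg (fun u hu => ?_)
    (fun u hu hu' => ?_) fun u hu hu' => ?_⟩
  · rw [habove u (hmid_of_high hu), htoda u (hpos (hmid_of_high hu))]
    exact hhigh u hu
  · rw [hbelow u hu', habove u hu, htoda u (hpos hu)]
    exact hmid u hu hu'
  · rw [htoda u hu]
    exact hlow u hu hu'

theorem exists_isFlip_configEnergy_le_of_emod_two (hδ₁ : 0 < δ₁) (hδ : δ₁ < δ₂)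
    (hωp : IsModuli ω p) (hτ : ∀ i, |τ i| ≤ 1)
    (hhigh : ∀ s t, highDensity a b s t ≤ highDensity a' b' (s % 2) (t % 2))
    (hmid : ∀ x y z, midDensity a b x y z ≤ midDensity a' b' (x % 2) (y % 2) (z % 2) + k)
    (hlow : ∀ r, lowDensity b r ≤ lowDensity b' (r % 2) + k') :
    ∃ τ', IsFlip τ τ' ∧ configEnergy δ₁ δ₂ a b ω p τ ≤
      configEnergy δ₁ δ₂ a' b' ω p τ' + (k * δ₁ + k' * (δ₂ - δ₁)) := by
  refine exists_isFlip_configEnergy_le hδ₁ hδ hωp hτ isPath_parity isPath_parity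
    (fun u _ => ?_) (fun u _ _ => ?_) fun u _ _ => ?_
  all_goals simp only [kdvCountAbove, kdvCountBelow, todaCount, ← spinSum_emod_two hτ]
  exacts [hhigh _ _, hmid _ _ _, hlow _]

theorem parity_of_odd {n : ℕ} (hn : Odd n) : parity n = 1 := by
  have := parity_eq n
  grind

theorem parity_of_even {n : ℕ} (hn : Even n) : parity n = 0 := by
  have := parity_eq n
  grind

theorem exists_isFlip_zero_one_le_two_one (hδ₁ : 0 < δ₁) (hδ : δ₁ < δ₂) (hωp : IsModuli ω p)
    (hτ : ∀ i, |τ i| ≤ 1) :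
    ∃ τ', IsFlip τ τ' ∧ configEnergy δ₁ δ₂ 0 1 ω p τ ≤ configEnergy δ₁ δ₂ 2 1 ω p τ' := by
  simpa using exists_isFlip_configEnergy_le_of_emod_two (k := 0) (k' := 0) hδ₁ hδ hωp hτ
    highDensity_zero_one_le (by simpa using midDensity_zero_one_le)
    (by simpa [lowDensity_one_emod_two] using lowDensity_one_nonpos)

theorem exists_isFlip_two_neg_one_le_two_one (hδ₁ : 0 < δ₁) (hδ : δ₁ < δ₂) (hωp : IsModuli ω p)
    (hτ : ∀ i, |τ i| ≤ 1) :
    ∃ τ', IsFlip τ τ' ∧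
      configEnergy δ₁ δ₂ 2 (-1) ω p τ ≤ configEnergy δ₁ δ₂ 2 1 ω p τ' + 4 * δ₁ := by
  simpa using exists_isFlip_configEnergy_le_of_emod_two (k := 4) (k' := 0) hδ₁ hδ hωp hτ
    highDensity_two_neg_one_le midDensity_two_neg_one_le
    (by simpa [lowDensity_one_emod_two] using lowDensity_neg_one_nonpos)

theorem exists_isFlip_zero_three_le_two_one (hδ₁ : 0 < δ₁) (hδ : δ₁ < δ₂) (hωp : IsModuli ω p)
    (hτ : ∀ i, |τ i| ≤ 1) :
    ∃ τ', IsFlip τ τ' ∧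
      configEnergy δ₁ δ₂ 0 3 ω p τ ≤ configEnergy δ₁ δ₂ 2 1 ω p τ' + 4 * δ₂ := by
  obtain ⟨τ', hττ', hle⟩ := exists_isFlip_configEnergy_le_of_emod_two (k := 4) (k' := 4) hδ₁ hδ hωp
    hτ highDensity_zero_three_le midDensity_zero_three_le
    (by simpa [lowDensity_one_emod_two] using lowDensity_three_le)
  exact ⟨τ', hττ', hle.trans_eq (by push_cast; ring)⟩

theorem exists_isFlip_two_one_le (hδ₁ : 0 < δ₁) (hδ : δ₁ < δ₂) (hωp : IsModuli ω p)
    (hτ : ∀ i, |τ i| ≤ 1) (hg : IsPath g) (hh : IsPath h)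
    (hhigh : ∀ u, δ₂ < u →
      highDensity 2 1 (parity (kdvCountAbove δ₁ δ₂ ω τ u)) (parity (todaCount p τ u)) =
      highDensity a b (g (kdvCountAbove δ₁ δ₂ ω τ u)) (h (todaCount p τ u)))
    (hmid : ∀ u, δ₂ - δ₁ < u → u ≤ δ₂ →
      midDensity 2 1 (parity (kdvCountBelow δ₂ ω τ u)) (parity (kdvCountAbove δ₁ δ₂ ω τ u))
        (parity (todaCount p τ u)) + k =
      midDensity a b (g (kdvCountBelow δ₂ ω τ u)) (g (kdvCountAbove δ₁ δ₂ ω τ u))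
        (h (todaCount p τ u)))
    (hlow : ∀ u, 0 < u → u ≤ δ₂ - δ₁ → lowDensity b (h (todaCount p τ u)) = k') :
    ∃ τ', IsFlip τ τ' ∧ configEnergy δ₁ δ₂ 2 1 ω p τ ≤
      configEnergy δ₁ δ₂ a b ω p τ' - (k * δ₁ + k' * (δ₂ - δ₁)) := by
  obtain ⟨τ', hττ', hle⟩ := exists_isFlip_configEnergy_le (k := -k) (k' := -k') (a := 2) (b := 1)
    hδ₁ hδ hωp hτ hg hh
    (fun u hu => (highDensity_two_one_le _ _).trans_eq (by
      rw [← hhigh u hu, spinSum_emod_two hτ, spinSum_emod_two hτ, kdvCountAbove, todaCount]))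
    (fun u hu hu' => (midDensity_two_one_le _ _ _).trans_eq (by
      rw [← hmid u hu hu', spinSum_emod_two hτ, spinSum_emod_two hτ, spinSum_emod_two hτ,
        kdvCountBelow, kdvCountAbove, todaCount, add_neg_cancel_right]))
    (fun u hu hu' => (lowDensity_one_nonpos _).trans_eq (by rw [hlow u hu hu', add_neg_cancel]))
  exact ⟨τ', hττ', hle.trans_eq (by push_cast; ring)⟩

theorem exists_isFlip_two_one_le_zero_one (hδ₁ : 0 < δ₁) (hδ : δ₁ < δ₂) (hωp : IsModuli ω p)
    (hτ : ∀ i, |τ i| ≤ 1) (hexc : ∀ u, ¬IsExceptional δ₁ δ₂ ω p τ u) :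
    ∃ τ', IsFlip τ τ' ∧ configEnergy δ₁ δ₂ 2 1 ω p τ ≤ configEnergy δ₁ δ₂ 0 1 ω p τ' := by
  have := exists_isFlip_two_one_le (k := 0) (k' := 0) (a := 0) (b := 1) hδ₁ hδ hωp hτ
    isPath_parity.neg isPath_parity (fun u hu => ?_) (fun u hu hu' => ?_)
    fun _ _ _ => lowDensity_one_emod_two _
  · simpa using this
  · obtain ⟨hs, ht⟩ := parity_eq_zero_of_not_isExceptionalHigh fun h => hexc u (.inl ⟨hu, h⟩)
    rw [hs, ht]
    rfl
  · rw [add_zero]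
    exact midDensity_zero_one_of_not_isExceptionalMid fun h => hexc u (.inr ⟨⟨hu, hu'⟩, h⟩)

theorem exists_isFlip_two_one_le_two_neg_one (hδ₁ : 0 < δ₁) (hδ : δ₁ < δ₂) (hωp : IsModuli ω p)
    (hτ : ∀ i, |τ i| ≤ 1) {v : ℝ} (hv : δ₂ - δ₁ < v)
    (hexc : ∀ u, v < u → ¬IsExceptional δ₁ δ₂ ω p τ u)
    (hkdv : Odd (kdvCountAbove δ₁ δ₂ ω τ v)) (htoda : Even (todaCount p τ v)) :
    ∃ τ', IsFlip τ τ' ∧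
      configEnergy δ₁ δ₂ 2 1 ω p τ ≤ configEnergy δ₁ δ₂ 2 (-1) ω p τ' - 4 * δ₁ := by
  have hg : ∀ {n}, kdvCountAbove δ₁ δ₂ ω τ v ≤ n →
      reflectedParity (kdvCountAbove δ₁ δ₂ ω τ v) n = 2 - parity n := fun h => by
    rw [reflectedParity_of_ge h, parity_of_odd hkdv, mul_one]
  have hh : ∀ {u}, u ≤ v →
      reflectedParity (todaCount p τ v) (todaCount p τ u) = -parity (todaCount p τ u) := fun h => by
    rw [reflectedParity_of_ge (todaCount_anti p τ h), parity_of_even htoda, mul_zero, zero_sub]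
  have := exists_isFlip_two_one_le (k := 4) (k' := 0) hδ₁ hδ hωp hτ
    (isPath_reflectedParity (kdvCountAbove δ₁ δ₂ ω τ v))
    (isPath_reflectedParity (todaCount p τ v)) (a := 2) (b := -1) (fun u hu => ?_)
    (fun u hu hu' => ?_) fun u _ hu' => ?_
  · simpa using this
  · rcases le_or_gt u v with huv | huv
    · rw [hg (kdvCountAbove_anti δ₁ δ₂ ω τ huv), hh huv, highDensity_eq_two_neg_one]
    · obtain ⟨hs, ht⟩ :=
        parity_eq_zero_of_not_isExceptionalHigh fun h => hexc u huv (.inl ⟨hu, h⟩)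
      rw [reflectedParity_of_le (kdvCountAbove_anti δ₁ δ₂ ω τ huv.le),
        reflectedParity_of_le (todaCount_anti p τ huv.le), hs, ht]
      rfl
  · rw [hg (kdvCountAbove_le_kdvCountBelow ω τ hu hv)]
    rcases le_or_gt u v with huv | huv
    · rw [hg (kdvCountAbove_anti δ₁ δ₂ ω τ huv), hh huv, midDensity_eq_two_neg_one]
    · rw [reflectedParity_of_le (kdvCountAbove_anti δ₁ δ₂ ω τ huv.le),
        reflectedParity_of_le (todaCount_anti p τ huv.le)]
      exact midDensity_two_neg_one_of_not_isExceptionalMid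
        fun h => hexc u huv (.inr ⟨⟨hu, hu'⟩, h⟩)
  · rw [hh (hu'.trans hv.le), lowDensity_neg_one_neg_parity]

theorem exists_isFlip_two_one_le_zero_three (hδ₁ : 0 < δ₁) (hδ : δ₁ < δ₂) (hωp : IsModuli ω p)
    (hτ : ∀ i, |τ i| ≤ 1) {v : ℝ} (hv : δ₂ - δ₁ < v)
    (hexc : ∀ u, v < u → ¬IsExceptional δ₁ δ₂ ω p τ u)
    (hkdv : v ≤ δ₂ → Odd (kdvCountBelow δ₂ ω τ v)) (htoda : Odd (todaCount p τ v)) :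
    ∃ τ', IsFlip τ τ' ∧
      configEnergy δ₁ δ₂ 2 1 ω p τ ≤ configEnergy δ₁ δ₂ 0 3 ω p τ' - 4 * δ₂ := by
  have habove : ∀ {u}, δ₂ - δ₁ < u →
      reflectedParity (kdvCountBelow δ₂ ω τ v) (kdvCountAbove δ₁ δ₂ ω τ u) =
        parity (kdvCountAbove δ₁ δ₂ ω τ u) := fun hu =>
    reflectedParity_of_le (kdvCountAbove_le_kdvCountBelow ω τ hv hu)
  have hh : ∀ {u}, u ≤ v →
      reflectedParity (todaCount p τ v) (todaCount p τ u) = 2 - parity (todaCount p τ u) :=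
    fun h => by
      rw [reflectedParity_of_ge (todaCount_anti p τ h), parity_of_odd htoda, mul_one]
  have := exists_isFlip_two_one_le (k := 4) (k' := 4) hδ₁ hδ hωp hτ
    (isPath_reflectedParity (kdvCountBelow δ₂ ω τ v)).neg
    (isPath_reflectedParity (todaCount p τ v)) (a := 0) (b := 3) (fun u hu => ?_)
    (fun u hu hu' => ?_) fun u _ hu' => ?_
  · obtain ⟨τ', hττ', hle⟩ := this
    exact ⟨τ', hττ', hle.trans_eq (by push_cast; ring)⟩
  · rw [habove ((sub_lt_self δ₂ hδ₁).trans hu)]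
    rcases le_or_gt u v with huv | huv
    · rw [hh huv, highDensity_eq_zero_three]
    · obtain ⟨hs, ht⟩ :=
        parity_eq_zero_of_not_isExceptionalHigh fun h => hexc u huv (.inl ⟨hu, h⟩)
      rw [reflectedParity_of_le (todaCount_anti p τ huv.le), hs, ht]
      rfl
  · rw [habove hu]
    rcases le_or_gt u v with huv | huv
    · rw [reflectedParity_of_le (kdvCountBelow_mono δ₂ ω τ huv), hh huv, midDensity_eq_zero_three]
    · rw [reflectedParity_of_ge (kdvCountBelow_mono δ₂ ω τ huv.le),
        parity_of_odd (hkdv (huv.le.trans hu')), mul_one,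
        reflectedParity_of_le (todaCount_anti p τ huv.le)]
      exact midDensity_zero_three_of_not_isExceptionalMid
        fun h => hexc u huv (.inr ⟨⟨hu, hu'⟩, h⟩)
  · rw [hh (hu'.trans hv.le), lowDensity_three_two_sub_parity]

theorem IsExceptional.kdv_or_toda (hδ₁ : 0 < δ₁) {v : ℝ} (hv : IsExceptional δ₁ δ₂ ω p τ v) :
    δ₂ - δ₁ < v ∧ (Odd (kdvCountAbove δ₁ δ₂ ω τ v) ∧ Even (todaCount p τ v) ∨
      (v ≤ δ₂ → Odd (kdvCountBelow δ₂ ω τ v)) ∧ Odd (todaCount p τ v)) := by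
  rcases hv with ⟨hv, hodd⟩ | ⟨⟨hv, -⟩, ⟨hkdv, htoda⟩ | hkdv⟩
  · refine ⟨(sub_lt_self δ₂ hδ₁).trans hv, ?_⟩
    rcases Nat.even_or_odd (todaCount p τ v) with heven | htoda
    · exact .inl ⟨hodd.resolve_right (Nat.not_odd_iff_even.mpr heven), heven⟩
    · exact .inr ⟨fun h => absurd hv h.not_gt, htoda⟩
  · exact ⟨hv, .inr ⟨fun _ => hkdv, htoda⟩⟩
  · exact ⟨hv, .inl hkdv⟩

theorem exists_isFlip_two_one_le_or (hδ₁ : 0 < δ₁) (hδ : δ₁ < δ₂) (hωp : IsModuli ω p)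
    (hτ : ∀ i, |τ i| ≤ 1) :
    ∃ τ', IsFlip τ τ' ∧ (configEnergy δ₁ δ₂ 2 1 ω p τ ≤ configEnergy δ₁ δ₂ 0 1 ω p τ' ∨
      configEnergy δ₁ δ₂ 2 1 ω p τ ≤ configEnergy δ₁ δ₂ 2 (-1) ω p τ' - 4 * δ₁ ∨
      configEnergy δ₁ δ₂ 2 1 ω p τ ≤ configEnergy δ₁ δ₂ 0 3 ω p τ' - 4 * δ₂) := by
  by_cases hexc : ∃ u, IsExceptional δ₁ δ₂ ω p τ u
  · obtain ⟨v, hv, hmax⟩ := exists_isGreatest_isExceptional ω p τ hexc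
    have hlast : ∀ u, v < u → ¬IsExceptional δ₁ δ₂ ω p τ u := fun u hu h => (hmax h).not_gt hu
    obtain ⟨hδv, ⟨hkdv, htoda⟩ | ⟨hkdv, htoda⟩⟩ := hv.kdv_or_toda hδ₁
    · obtain ⟨τ', hττ', hle⟩ :=
        exists_isFlip_two_one_le_two_neg_one hδ₁ hδ hωp hτ hδv hlast hkdv htoda
      exact ⟨τ', hττ', .inr (.inl hle)⟩
    · obtain ⟨τ', hττ', hle⟩ :=
        exists_isFlip_two_one_le_zero_three hδ₁ hδ hωp hτ hδv hlast hkdv htoda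
      exact ⟨τ', hττ', .inr (.inr hle)⟩
  · obtain ⟨τ', hττ', hle⟩ :=
      exists_isFlip_two_one_le_zero_one hδ₁ hδ hωp hτ (not_exists.mp hexc)
    exact ⟨τ', hττ', .inl hle⟩

theorem exists_isFlip_configEnergy_le_of_toda_eq_zero (hδ₁ : 0 < δ₁) (hδ : δ₁ < δ₂)
    (hω : ∀ i, 0 ≤ ω i) (hp : ∀ i, p i = 0) (hτ : ∀ i, |τ i| ≤ 1)
    (hhigh : ∀ s, highDensity a b s 0 ≤ highDensity a' b' (s % 2) 0)
    (hmid : ∀ x y, midDensity a b x y 0 ≤ midDensity a' b' (x % 2) (y % 2) 0 + k) :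
    ∃ τ', IsFlip τ τ' ∧
      configEnergy δ₁ δ₂ a b ω p τ ≤ configEnergy δ₁ δ₂ a' b' ω p τ' + k * δ₁ := by
  have hωp : IsModuli ω p := ⟨hω, fun i => (hp i).ge, fun i => .inr (hp i)⟩
  have hzero : ∀ u, 0 < u → spinSum τ p (Set.Ici u) = 0 ∧ parity (todaCount p τ u) = 0 :=
    fun u hu => by
      have hsum : spinSum τ p (Set.Ici u) = 0 := by simp [spinSum, hp, hu.not_ge]
      rw [todaCount, ← spinSum_emod_two hτ, hsum]
      exact ⟨rfl, rfl⟩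
  have hpos : ∀ {u}, δ₂ - δ₁ < u → 0 < u := (sub_pos.mpr hδ).trans
  have := exists_isFlip_configEnergy_le (k := k) (k' := 0) hδ₁ hδ hωp hτ isPath_parity
    isPath_parity (a := a) (b := b) (a' := a') (b' := b') (fun u hu => ?_) (fun u hu _ => ?_)
    fun u hu _ => ?_
  · simpa using this
  · obtain ⟨hsum, hcount⟩ := hzero u (hpos ((sub_lt_self δ₂ hδ₁).trans hu))
    rw [hsum, hcount, kdvCountAbove, ← spinSum_emod_two hτ]
    exact hhigh _
  · obtain ⟨hsum, hcount⟩ := hzero u (hpos hu)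
    rw [hsum, hcount, kdvCountAbove, kdvCountBelow, ← spinSum_emod_two hτ, ← spinSum_emod_two hτ]
    exact hmid _ _
  · obtain ⟨hsum, hcount⟩ := hzero u hu
    rw [hsum, hcount, lowDensity_zero, lowDensity_zero, add_zero]

end Moves

section Solitons

/-- The sign of a real number, with value `1` at `0`, so that its square is always `1`. -/
def sgn (x : ℝ) : ℤ := if 0 ≤ x then 1 else -1

theorem sgn_of_nonneg {x : ℝ} (hx : 0 ≤ x) : sgn x = 1 := if_pos hx

theorem sgn_of_neg {x : ℝ} (hx : x < 0) : sgn x = -1 := if_neg hx.not_ge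

theorem sgn_mul_self (x : ℝ) : sgn x * sgn x = 1 := by
  rcases le_or_gt 0 x with hx | hx
  · rw [sgn_of_nonneg hx, one_mul]
  · rw [sgn_of_neg hx, neg_mul_neg, one_mul]

theorem eq_sgn_mul_abs_of_odd {f : ℝ → ℝ} (hf : f.Odd) (x : ℝ) : f x = sgn x * f |x| := by
  rcases le_or_gt 0 x with hx | hx
  · rw [sgn_of_nonneg hx, abs_of_nonneg hx, Int.cast_one, one_mul]
  · rw [sgn_of_neg hx, abs_of_neg hx, hf, Int.cast_neg, Int.cast_one, neg_mul_neg, one_mul]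

theorem eq_sgn_mul_sgn_mul_abs_of_odd {f : ℝ → ℝ → ℝ} (hleft : ∀ y, (f · y).Odd)
    (hright : ∀ x, (f x).Odd) (x y : ℝ) : f x y = sgn x * sgn y * f |x| |y| := by
  rw [eq_sgn_mul_abs_of_odd (hleft y), eq_sgn_mul_abs_of_odd (hright |x|), mul_assoc]

theorem odd_dispK (δ₁ : ℝ) : (dispK δ₁).Odd := fun Ω => by
  rw [dispK, dispK, ← abs_neg, ← abs_neg (-Ω + δ₁)]
  ring_nf

theorem odd_dispQ (δ₂ : ℝ) : (dispQ δ₂).Odd := fun P => by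
  rw [dispQ, dispQ]
  grind

theorem interKdV_comm (Ω Ω' : ℝ) : interKdV Ω Ω' = interKdV Ω' Ω := by
  rw [interKdV, interKdV, max_comm, min_comm, min_comm Ω]

theorem interToda_comm (δ₂ P P' : ℝ) : interToda δ₂ P P' = interToda δ₂ P' P := by
  rw [interToda, interToda, max_comm, min_comm, min_comm (-2 * P - _)]

theorem odd_interKdV (Ω : ℝ) : (interKdV Ω).Odd := fun Ω' => by
  rw [interKdV, interKdV]
  grind

theorem odd_interToda (δ₂ P : ℝ) : (interToda δ₂ P).Odd := fun P' => by
  rw [interToda, interToda, odd_dispQ]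
  grind

theorem odd_interKdV_left (Ω' : ℝ) : (interKdV · Ω').Odd := by
  simpa only [interKdV_comm _ Ω'] using odd_interKdV Ω'

theorem odd_interToda_left (δ₂ P' : ℝ) : (interToda δ₂ · P').Odd := by
  simpa only [interToda_comm δ₂ _ P'] using odd_interToda δ₂ P'

theorem odd_interMixed_left (δ₁ δ₂ P : ℝ) : (interMixed δ₁ δ₂ · P).Odd := fun Ω => by
  simp only [interMixed, odd_dispK δ₁ Ω]
  grind

theorem odd_interMixed (δ₁ δ₂ Ω : ℝ) : (interMixed δ₁ δ₂ Ω).Odd := fun P => by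
  simp only [interMixed, odd_dispQ δ₂ P]
  grind

variable {N M : ℕ}

/-- The moduli of the parameters of KdV type, and `0` at the indices of Toda type. -/
def kdvModuli (Ω : Fin N → ℝ) (M : ℕ) : Fin (N + M) → ℝ :=
  Fin.append (fun a => |Ω a|) fun _ => 0

/-- The moduli of the parameters of Toda type, and `0` at the indices of KdV type. -/
def todaModuli (N : ℕ) (P : Fin M → ℝ) : Fin (N + M) → ℝ :=
  Fin.append (fun _ => 0) fun b => |P b|

/-- The signs of the parameters; they turn spins of the solitons into spins of the moduli. -/
def signs (Ω : Fin N → ℝ) (P : Fin M → ℝ) : Fin (N + M) → ℤ :=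
  Fin.append (fun a => sgn (Ω a)) fun b => sgn (P b)

variable {δ₁ δ₂ : ℝ} (Ω : Fin N → ℝ) (P : Fin M → ℝ) (C : Fin (N + M) → ℝ)

theorem isModuli : IsModuli (kdvModuli Ω M) (todaModuli N P) := by
  constructor <;> refine Fin.addCases (fun a => ?_) fun b => ?_ <;> simp [kdvModuli, todaModuli]

theorem signs_mul_self (i : Fin (N + M)) : signs Ω P i * signs Ω P i = 1 := by
  induction i using Fin.addCases <;> simp [signs, sgn_mul_self]

theorem phase_eq (i : Fin (N + M)) (m n : ℤ) :
    phase δ₁ δ₂ Ω P C i m n =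
      signs Ω P i * field δ₁ δ₂ m n (kdvModuli Ω M i) (todaModuli N P i) + C i := by
  induction i using Fin.addCases with
  | left a =>
    have hΩ : Ω a = sgn (Ω a) * |Ω a| := eq_sgn_mul_abs_of_odd (f := id) (fun _ => rfl) (Ω a)
    simp only [phase, signs, kdvModuli, todaModuli, field, Fin.addCases_left, Fin.append_left,
      (odd_dispQ δ₂).map_zero]
    linear_combination m * hΩ + n * eq_sgn_mul_abs_of_odd (odd_dispK δ₁) (Ω a)
  | right b =>
    have hP : P b = sgn (P b) * |P b| := eq_sgn_mul_abs_of_odd (f := id) (fun _ => rfl) (P b)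
    simp only [phase, signs, kdvModuli, todaModuli, field, Fin.addCases_right, Fin.append_right,
      (odd_dispK δ₁).map_zero]
    linear_combination m * eq_sgn_mul_abs_of_odd (odd_dispQ δ₂) (P b) + n * hP

theorem inter_comm (i j : Fin (N + M)) : inter δ₁ δ₂ Ω P i j = inter δ₁ δ₂ Ω P j i := by
  induction i using Fin.addCases <;> induction j using Fin.addCases <;>
    simp only [inter, Fin.addCases_left, Fin.addCases_right]
  exacts [interKdV_comm _ _, interToda_comm _ _ _]

theorem inter_eq (i j : Fin (N + M)) :
    inter δ₁ δ₂ Ω P i j = signs Ω P i * signs Ω P j *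
      coupling δ₁ δ₂ (kdvModuli Ω M i) (todaModuli N P i) (kdvModuli Ω M j) (todaModuli N P j) := by
  have hKdV := eq_sgn_mul_sgn_mul_abs_of_odd odd_interKdV_left odd_interKdV
  have hToda := eq_sgn_mul_sgn_mul_abs_of_odd (odd_interToda_left δ₂) (odd_interToda δ₂)
  have hMixed := eq_sgn_mul_sgn_mul_abs_of_odd (odd_interMixed_left δ₁ δ₂) (odd_interMixed δ₁ δ₂)
  induction i using Fin.addCases <;> induction j using Fin.addCases <;>
    simp only [inter, signs, kdvModuli, todaModuli, coupling, Fin.addCases_left,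
      Fin.addCases_right, Fin.append_left, Fin.append_right, (odd_interKdV _).map_zero,
      (odd_interKdV_left _).map_zero, (odd_interToda _ _).map_zero,
      (odd_interToda_left _ _).map_zero, (odd_interMixed _ _ _).map_zero,
      (odd_interMixed_left _ _ _).map_zero, add_zero, zero_add]
  exacts [hKdV _ _, hMixed _ _, by rw [hMixed, mul_comm (sgn _ : ℝ)], hToda _ _]

theorem spinEnergy_phase_sub (m₁ n₁ m₂ n₂ : ℤ) (τ : Fin (N + M) → ℤ) :
    spinEnergy (fun i => phase δ₁ δ₂ Ω P C i m₁ n₁ - phase δ₁ δ₂ Ω P C i m₂ n₂)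
      (inter δ₁ δ₂ Ω P) τ =
    configEnergy δ₁ δ₂ (m₁ - m₂) (n₁ - n₂) (kdvModuli Ω M) (todaModuli N P)
      fun i => signs Ω P i * τ i := by
  rw [configEnergy, spinEnergy_mul]
  congr 1
  · funext i
    simp only [phase_eq, field]
    push_cast
    ring
  · exact funext₂ (inter_eq Ω P)

theorem exists_spin_mixedSoliton_add_le (δ₁ δ₂ : ℝ) (m₁ n₁ m₂ n₂ : ℤ) :
    ∃ τ : Fin (N + M) → ℤ, (∀ i, |τ i| ≤ 1) ∧
      ∀ (m₁' n₁' m₂' n₂' : ℤ) (τ' : Fin (N + M) → ℤ) (c : ℝ),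
        m₁ + m₂ = m₁' + m₂' → n₁ + n₂ = n₁' + n₂' → IsFlip τ τ' →
        configEnergy δ₁ δ₂ (m₁ - m₂) (n₁ - n₂) (kdvModuli Ω M) (todaModuli N P) τ ≤
          configEnergy δ₁ δ₂ (m₁' - m₂') (n₁' - n₂') (kdvModuli Ω M) (todaModuli N P) τ' + 4 * c →
        mixedSoliton δ₁ δ₂ Ω P C m₁ n₁ + mixedSoliton δ₁ δ₂ Ω P C m₂ n₂ ≤
          mixedSoliton δ₁ δ₂ Ω P C m₁' n₁' + mixedSoliton δ₁ δ₂ Ω P C m₂' n₂' + c := by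
  obtain ⟨τ, hτ, hle⟩ := exists_spin_maxWeight_add_le (inter_comm (δ₁ := δ₁) (δ₂ := δ₂) Ω P)
    (phase δ₁ δ₂ Ω P C · m₁ n₁) (phase δ₁ δ₂ Ω P C · m₂ n₂)
  have hsigns : ∀ τ : Fin (N + M) → ℤ, (fun i => signs Ω P i * (signs Ω P i * τ i)) = τ :=
    fun τ => funext fun i => by rw [← mul_assoc, signs_mul_self, one_mul]
  refine ⟨fun i => signs Ω P i * τ i, fun i => ?_, fun m₁' n₁' m₂' n₂' τ' c hm hn hflip henergy =>
    hle (phase δ₁ δ₂ Ω P C · m₁' n₁') (phase δ₁ δ₂ Ω P C · m₂' n₂')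
      (fun i => signs Ω P i * τ' i) c (fun i => ?_) ?_ ?_⟩
  · rw [abs_mul, Int.isUnit_iff_abs_eq.mp (.of_mul_eq_one _ (signs_mul_self Ω P i)), one_mul]
    exact hτ i
  · have hm' : (m₁ + m₂ : ℝ) = m₁' + m₂' := by exact_mod_cast hm
    have hn' : (n₁ + n₂ : ℝ) = n₁' + n₂' := by exact_mod_cast hn
    simp only [phase_eq, field]
    linear_combination signs Ω P i * (kdvModuli Ω M i + dispQ δ₂ (todaModuli N P i)) * hm' +
      signs Ω P i * (todaModuli N P i + dispK δ₁ (kdvModuli Ω M i)) * hn'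
  · simpa only [hsigns] using hflip.mul (signs Ω P)
  · rwa [spinEnergy_phase_sub, spinEnergy_phase_sub, hsigns]

theorem mixedSoliton_add_le {m₁ n₁ m₂ n₂ m₁' n₁' m₂' n₂' a b a' b' : ℤ} {c : ℝ}
    (henergy : ∀ τ : Fin (N + M) → ℤ, (∀ i, |τ i| ≤ 1) → ∃ τ', IsFlip τ τ' ∧
      configEnergy δ₁ δ₂ a b (kdvModuli Ω M) (todaModuli N P) τ ≤
        configEnergy δ₁ δ₂ a' b' (kdvModuli Ω M) (todaModuli N P) τ' + 4 * c)
    (hm : m₁ + m₂ = m₁' + m₂' := by omega) (hn : n₁ + n₂ = n₁' + n₂' := by omega)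
    (ha : m₁ - m₂ = a := by omega) (hb : n₁ - n₂ = b := by omega)
    (ha' : m₁' - m₂' = a' := by omega) (hb' : n₁' - n₂' = b' := by omega) :
    mixedSoliton δ₁ δ₂ Ω P C m₁ n₁ + mixedSoliton δ₁ δ₂ Ω P C m₂ n₂ ≤
      mixedSoliton δ₁ δ₂ Ω P C m₁' n₁' + mixedSoliton δ₁ δ₂ Ω P C m₂' n₂' + c := by
  subst ha hb ha' hb'
  obtain ⟨τ, hτ, hle⟩ := exists_spin_mixedSoliton_add_le Ω P C δ₁ δ₂ m₁ n₁ m₂ n₂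
  obtain ⟨τ', hflip, hττ'⟩ := henergy τ hτ
  exact hle m₁' n₁' m₂' n₂' τ' c hm hn hflip hττ'

theorem mixedSoliton_add_one_add_le_max (hδ₁ : 0 < δ₁) (hδ : δ₁ < δ₂) (m n : ℤ) :
    mixedSoliton δ₁ δ₂ Ω P C (m + 1) (n + 1) + mixedSoliton δ₁ δ₂ Ω P C (m - 1) n ≤
      max (mixedSoliton δ₁ δ₂ Ω P C m (n + 1) + mixedSoliton δ₁ δ₂ Ω P C m n)
        (max (mixedSoliton δ₁ δ₂ Ω P C (m + 1) n + mixedSoliton δ₁ δ₂ Ω P C (m - 1) (n + 1) - δ₁)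
          (mixedSoliton δ₁ δ₂ Ω P C m (n + 2) + mixedSoliton δ₁ δ₂ Ω P C m (n - 1) - δ₂)) := by
  obtain ⟨τ, hτ, hle⟩ := exists_spin_mixedSoliton_add_le Ω P C δ₁ δ₂ (m + 1) (n + 1) (m - 1) n
  have hdm : m + 1 - (m - 1) = 2 := by ring
  rw [hdm, add_sub_cancel_left] at hle
  obtain ⟨τ', hflip, h | h | h⟩ := exists_isFlip_two_one_le_or hδ₁ hδ (isModuli Ω P) hτ
  · refine le_max_of_le_left ?_
    simpa using hle m (n + 1) m n τ' 0 (by ring) (by ring) hflip (by simpa using h)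
  · refine le_max_of_le_right (le_max_of_le_left ?_)
    refine hle (m + 1) n (m - 1) (n + 1) τ' (-δ₁) (by ring) (by ring) hflip ?_
    rw [hdm, sub_add_cancel_left]
    linarith
  · refine le_max_of_le_right (le_max_of_le_right ?_)
    refine hle m (n + 2) m (n - 1) τ' (-δ₂) (by ring) (by ring) hflip ?_
    rw [sub_self, show n + 2 - (n - 1) = 3 by ring]
    linarith

theorem solvesEBB_mixedSoliton (hδ₁ : 0 < δ₁) (hδ : δ₁ < δ₂) :
    SolvesEBB δ₁ δ₂ (mixedSoliton δ₁ δ₂ Ω P C) := by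
  intro m n
  have hωp := isModuli Ω P
  refine (mixedSoliton_add_one_add_le_max Ω P C hδ₁ hδ m n).antisymm (max_le ?_ (max_le ?_ ?_))
  · simpa using mixedSoliton_add_le Ω P C (c := 0) fun τ hτ => by
      simpa using exists_isFlip_zero_one_le_two_one hδ₁ hδ hωp hτ
  · exact sub_le_iff_le_add.mpr (mixedSoliton_add_le Ω P C fun τ hτ =>
      exists_isFlip_two_neg_one_le_two_one hδ₁ hδ hωp hτ)
  · exact sub_le_iff_le_add.mpr (mixedSoliton_add_le Ω P C fun τ hτ =>
      exists_isFlip_zero_three_le_two_one hδ₁ hδ hωp hτ)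

end Solitons

section Asymptotics

open Filter

/-- The function `F` agrees near `l`, in each row, with one and the same affine function. -/
def IsEventuallyAffine (l : Filter ℤ) (F : ℤ → ℤ → ℝ) : Prop :=
  ∃ α β γ : ℝ, ∀ m : ℤ, ∀ᶠ n : ℤ in l, F m n = α * m + β * n + γ

section Subsets

variable {ι : Type*} {k a : ι → ℝ} {I I' : Finset ι}

theorem mem_iff_neg_of_forall_sum_le (hI : ∀ J : Finset ι, ∑ i ∈ I, k i ≤ ∑ i ∈ J, k i) {i : ι}
    (hi : k i ≠ 0) : i ∈ I ↔ k i < 0 := by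
  classical
  refine ⟨fun hmem => lt_of_le_of_ne ?_ hi, fun hneg => ?_⟩
  · linarith [hI (I.erase i), Finset.add_sum_erase I k hmem]
  · by_contra hmem
    linarith [hI (insert i I), Finset.sum_insert (f := k) hmem]

theorem sum_eq_sum_of_forall_sum_le (hI : ∀ J : Finset ι, ∑ i ∈ I, k i ≤ ∑ i ∈ J, k i)
    (hI' : ∀ J : Finset ι, ∑ i ∈ I', k i ≤ ∑ i ∈ J, k i) (hka : ∀ i, k i = 0 → a i = 0) :
    ∑ i ∈ I, a i = ∑ i ∈ I', a i := by
  have hmem : ∀ i, k i ≠ 0 → (i ∈ I ↔ i ∈ I') := fun i hi =>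
    (mem_iff_neg_of_forall_sum_le hI hi).trans (mem_iff_neg_of_forall_sum_le hI' hi).symm
  refine Finset.sum_congr_of_eq_on_inter (fun i hi hi' => ?_) (fun i hi hi' => ?_) fun _ _ _ => rfl
  · exact hka i (by_contra fun hk => hi' ((hmem i hk).mp hi))
  · exact hka i (by_contra fun hk => hi' ((hmem i hk).mpr hi))

variable [LinearOrder ι]

theorem weight_affine (a k c : ι → ℝ) (B : ι → ι → ℝ) (m n : ℤ) (I : Finset ι) :
    weight (fun i => a i * m + k i * n + c i) B I =
      (∑ i ∈ I, a i) * m + (∑ i ∈ I, k i) * n + weight c B I := by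
  rw [weight, weight, Finset.sum_add_distrib, Finset.sum_add_distrib, Finset.sum_mul,
    Finset.sum_mul]
  ring

theorem exists_forall_sum_lt_or [Finite ι] (hka : ∀ i, k i = 0 → a i = 0) (c : ι → ℝ)
    (B : ι → ι → ℝ) :
    ∃ I₀ : Finset ι, ∀ I, ∑ i ∈ I₀, k i < ∑ i ∈ I, k i ∨
      ∑ i ∈ I, k i = ∑ i ∈ I₀, k i ∧ ∑ i ∈ I, a i = ∑ i ∈ I₀, a i ∧
        weight c B I ≤ weight c B I₀ := by
  obtain ⟨I₀, hI₀⟩ := Finite.exists_min fun I : Finset ι => toLex (∑ i ∈ I, k i, -weight c B I)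
  simp only [Prod.Lex.toLex_le_toLex, neg_le_neg_iff] at hI₀
  have hmin : ∀ J : Finset ι, ∑ i ∈ I₀, k i ≤ ∑ i ∈ J, k i := fun J =>
    (hI₀ J).elim le_of_lt fun h => h.1.le
  refine ⟨I₀, fun I => (hI₀ I).imp_right fun ⟨hk, hweight⟩ => ⟨hk.symm, ?_, hweight⟩⟩
  exact sum_eq_sum_of_forall_sum_le (fun J => hk ▸ hmin J) hmin hka

/-- Near `-∞` the subsets whose slope in `n` is minimal dominate, and among them only the constant
term matters because they have the same slope in `m`. -/
theorem isEventuallyAffine_maxWeight [Fintype ι] (hka : ∀ i, k i = 0 → a i = 0) (c : ι → ℝ)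
    (B : ι → ι → ℝ) :
    IsEventuallyAffine atBot fun m n => maxWeight (fun i => a i * m + k i * n + c i) B := by
  obtain ⟨I₀, hI₀⟩ := exists_forall_sum_lt_or hka c B
  refine ⟨∑ i ∈ I₀, a i, ∑ i ∈ I₀, k i, weight c B I₀, fun m => ?_⟩
  have hle : ∀ᶠ n : ℤ in atBot, ∀ I, weight (fun i => a i * m + k i * n + c i) B I ≤
      weight (fun i => a i * m + k i * n + c i) B I₀ := by
    refine eventually_all.mpr fun I => ?_
    simp only [weight_affine]
    rcases hI₀ I with hlt | ⟨hk, ha, hweight⟩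
    · have hlim : Tendsto (fun n : ℤ => (∑ i ∈ I, k i - ∑ i ∈ I₀, k i) * (n : ℝ)) atBot atBot :=
        (tendsto_intCast_atBot_iff.mpr tendsto_id).const_mul_atBot (sub_pos.mpr hlt)
      filter_upwards [hlim.eventually_le_atBot
        ((∑ i ∈ I₀, a i) * m + weight c B I₀ - ((∑ i ∈ I, a i) * m + weight c B I))] with n hn
      linarith
    · simp only [hk, ha, add_le_add_iff_left, hweight, eventually_true]
  filter_upwards [hle] with n hn
  rw [← weight_affine]
  exact le_antisymm (Finset.sup'_le _ _ fun I _ => hn I) (weight_le_maxWeight _ B I₀)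

end Subsets

namespace IsEventuallyAffine

variable {l : Filter ℤ} {F : ℤ → ℤ → ℝ}

theorem comp_neg (hF : IsEventuallyAffine atBot fun m n => F m (-n)) :
    IsEventuallyAffine atTop F := by
  obtain ⟨α, β, γ, h⟩ := hF
  refine ⟨α, -β, γ, fun m => ?_⟩
  filter_upwards [tendsto_neg_atTop_atBot.eventually (h m)] with n hn
  rw [neg_neg] at hn
  rw [hn]
  push_cast
  ring

theorem eventually_fieldU_eq_zero (hF : IsEventuallyAffine l F) (hl : Tendsto (· + 1) l l)
    (m : ℤ) : ∀ᶠ n in l, fieldU F m n = 0 := by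
  obtain ⟨α, β, γ, h⟩ := hF
  filter_upwards [h m, h (m + 1), hl.eventually (h m), hl.eventually (h (m + 1))] with n h₁ h₂ h₃ h₄
  rw [fieldU, h₁, h₂, h₃, h₄]
  ring

theorem eventually_fieldV_eq_zero (hF : IsEventuallyAffine l F) (m : ℤ) :
    ∀ᶠ n in l, fieldV F m n = 0 := by
  obtain ⟨α, β, γ, h⟩ := hF
  filter_upwards [h m, h (m + 1), h (m - 1)] with n h₁ h₂ h₃
  rw [fieldV, h₁, h₂, h₃]
  push_cast
  ring

theorem eventually_fieldX_eq_zero (hF : IsEventuallyAffine l F) (hl : Tendsto (· + 1) l l)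
    (hl' : Tendsto (· - 1) l l) (m : ℤ) : ∀ᶠ n in l, fieldX F m n = 0 := by
  obtain ⟨α, β, γ, h⟩ := hF
  filter_upwards [h m, hl.eventually (h m), hl'.eventually (h m)] with n h₁ h₂ h₃
  rw [fieldX, h₁, h₂, h₃]
  push_cast
  ring

end IsEventuallyAffine

end Asymptotics

section BoxBall

open Filter

variable {δ₁ δ₂ : ℝ} {F : ℤ → ℤ → ℝ}

theorem sum_Ioc_sub_sub_one (V : ℤ → ℝ) {l n : ℤ} (hln : l ≤ n) :
    ∑ k ∈ Finset.Ioc l n, (V k - V (k - 1)) = V n - V l := by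
  induction n, hln using Int.leInduction with
  | base => simp
  | succ n hn ih =>
    rw [← Finset.insert_Ioc_right_eq_Ioc_add_one hn, Finset.sum_insert (by simp), ih,
      add_sub_cancel_right, sub_add_sub_cancel]

theorem carrierLoad_eq {u u' V : ℤ → ℝ} (huV : ∀ k, u (k - 1) - u' (k - 1) = V k - V (k - 1))
    (hV : ∀ᶠ k in atBot, V k = 0) (n : ℤ) : carrierLoad u u' n = V n := by
  obtain ⟨l, hl⟩ := eventually_atBot.mp (hV.and (eventually_le_atBot n))
  rw [← sub_zero (V n), ← (hl l le_rfl).1, ← sum_Ioc_sub_sub_one V (hl l le_rfl).2, carrierLoad]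
  simp only [huV]
  refine finsum_mem_eq_sum_of_inter_support_eq (s := Set.Iic n) _ (Set.ext fun k => ?_)
  simp only [Set.mem_inter_iff, Function.mem_support, Finset.coe_Ioc, Set.mem_Ioc, Set.mem_Iic]
  refine and_congr_left fun hk => (and_iff_right ?_).symm
  by_contra! hkl
  exact hk (by rw [(hl k hkl).1, (hl (k - 1) (by omega)).1, sub_zero])

theorem carrierLoad_fieldU (hF : IsEventuallyAffine atBot F) (m n : ℤ) :
    carrierLoad (fieldU F (m - 1)) (fieldU F m) n = fieldV F m n := by
  refine carrierLoad_eq (fun k => ?_) (hF.eventually_fieldV_eq_zero m) n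
  simp only [fieldU, fieldV, sub_add_cancel]
  ring

theorem SolvesEBB.fieldU_eq_min (hF : SolvesEBB δ₁ δ₂ F) (hδ : δ₁ ≤ δ₂)
    (hX : ∀ m n, fieldX F m n + fieldX F m (n + 1) ≤ δ₁) (m n : ℤ) :
    fieldU F m n = min (fieldV F m n) (δ₁ - fieldU F (m - 1) n) := by
  have hEBB := hF m n
  have hXX := hX m n
  simp only [fieldU, fieldV, fieldX, sub_add_cancel, add_sub_cancel_right] at *
  rw [add_assoc n, one_add_one_eq_two] at hXX
  grind

theorem isBoxBallEvolution_fieldU (hF : SolvesEBB δ₁ δ₂ F) (hδ : δ₁ ≤ δ₂)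
    (hbot : IsEventuallyAffine atBot F) (htop : IsEventuallyAffine atTop F)
    (hX : ∀ m n, fieldX F m n + fieldX F m (n + 1) ≤ δ₁) (hU : ∀ m n, 0 ≤ fieldU F m n)
    (hU' : ∀ m n, fieldU F m n ≤ δ₁) : IsBoxBallEvolution δ₁ (fieldU F) where
  state m :=
    { nonneg := hU m
      le_capacity := hU' m
      finite_support := by
        refine eventually_cofinite.mp ?_
        rw [Int.cofinite_eq]
        exact eventually_sup.mpr
          ⟨hbot.eventually_fieldU_eq_zero (tendsto_atBot_add_const_right _ 1 tendsto_id) m,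
            htop.eventually_fieldU_eq_zero (tendsto_atTop_add_const_right _ 1 tendsto_id) m⟩ }
  step m n := by
    rw [carrierLoad_fieldU hbot]
    exact hF.fieldU_eq_min hδ hX m n

variable {N M : ℕ} (Ω : Fin N → ℝ) {P : Fin M → ℝ} (C : Fin (N + M) → ℝ)

theorem todaModuli_eq_zero (hP : ∀ b, P b = 0) (i : Fin (N + M)) : todaModuli N P i = 0 := by
  induction i using Fin.addCases <;> simp [todaModuli, hP]

theorem fieldX_add_fieldX_le (hδ₁ : 0 < δ₁) (hδ : δ₁ < δ₂) (hP : ∀ b, P b = 0) (m n : ℤ) :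
    fieldX (mixedSoliton δ₁ δ₂ Ω P C) m n + fieldX (mixedSoliton δ₁ δ₂ Ω P C) m (n + 1) ≤ δ₁ := by
  set F := mixedSoliton δ₁ δ₂ Ω P C
  have hle : F m (n + 2) + F m (n - 1) ≤ F m n + F m (n + 1) + δ₁ :=
    mixedSoliton_add_le Ω P C fun τ hτ =>
      exists_isFlip_configEnergy_le_of_toda_eq_zero hδ₁ hδ (isModuli Ω P).kdv_nonneg
        (todaModuli_eq_zero hP) hτ kdv_highDensity_zero_three_le kdv_midDensity_zero_three_le
  simp only [fieldX, add_sub_cancel_right, add_assoc n, one_add_one_eq_two]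
  linarith

theorem fieldU_nonneg (hδ₁ : 0 < δ₁) (hδ : δ₁ < δ₂) (hP : ∀ b, P b = 0) (m n : ℤ) :
    0 ≤ fieldU (mixedSoliton δ₁ δ₂ Ω P C) m n := by
  set F := mixedSoliton δ₁ δ₂ Ω P C
  have hle : F (m + 1) (n + 1) + F m n ≤ F (m + 1) n + F m (n + 1) + 0 :=
    mixedSoliton_add_le Ω P C fun τ hτ => by
      simpa using exists_isFlip_configEnergy_le_of_toda_eq_zero (k := 0) hδ₁ hδ
        (isModuli Ω P).kdv_nonneg (todaModuli_eq_zero hP) hτ (kdv_highDensity_one_le · 1 (-1))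
        (by simpa using kdv_midDensity_one_one_le)
  rw [fieldU]
  linarith

theorem fieldU_le (hδ₁ : 0 < δ₁) (hδ : δ₁ < δ₂) (hP : ∀ b, P b = 0) (m n : ℤ) :
    fieldU (mixedSoliton δ₁ δ₂ Ω P C) m n ≤ δ₁ := by
  set F := mixedSoliton δ₁ δ₂ Ω P C
  have hle : F (m + 1) n + F m (n + 1) ≤ F (m + 1) (n + 1) + F m n + δ₁ :=
    mixedSoliton_add_le Ω P C fun τ hτ =>
      exists_isFlip_configEnergy_le_of_toda_eq_zero hδ₁ hδ (isModuli Ω P).kdv_nonneg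
        (todaModuli_eq_zero hP) hτ (kdv_highDensity_one_le · (-1) 1) kdv_midDensity_one_neg_one_le
  rw [fieldU]
  linarith

theorem eq_zero_of_dispK_eq_zero (hδ₁ : 0 < δ₁) {Ω : ℝ} (hΩ : dispK δ₁ Ω = 0) : Ω = 0 := by
  rw [dispK] at hΩ
  grind

theorem append_eq_zero_of_append_dispK_eq_zero (hδ₁ : 0 < δ₁) {i : Fin (N + M)}
    (hi : Fin.append (fun a => dispK δ₁ (Ω a)) (0 : Fin M → ℝ) i = 0) :
    Fin.append Ω (0 : Fin M → ℝ) i = 0 := by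
  induction i using Fin.addCases with
  | left a => simpa using eq_zero_of_dispK_eq_zero hδ₁ (by simpa using hi)
  | right b => simp

theorem mixedSoliton_eq_maxWeight (hP : ∀ b, P b = 0) (m n : ℤ) :
    mixedSoliton δ₁ δ₂ Ω P C m n = maxWeight
      (fun i => Fin.append Ω (0 : Fin M → ℝ) i * m +
        Fin.append (fun a => dispK δ₁ (Ω a)) (0 : Fin M → ℝ) i * n + C i)
      (inter δ₁ δ₂ Ω P) := by
  refine congrArg (maxWeight · _) (funext fun i => ?_)
  induction i using Fin.addCases <;> simp [phase, hP, (odd_dispQ δ₂).map_zero]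

theorem isEventuallyAffine_atBot_mixedSoliton (hδ₁ : 0 < δ₁) (hP : ∀ b, P b = 0) :
    IsEventuallyAffine atBot (mixedSoliton δ₁ δ₂ Ω P C) := by
  rw [funext₂ (mixedSoliton_eq_maxWeight Ω C hP)]
  exact isEventuallyAffine_maxWeight
    (fun _ => append_eq_zero_of_append_dispK_eq_zero Ω hδ₁) C (inter δ₁ δ₂ Ω P)

theorem isEventuallyAffine_atTop_mixedSoliton (hδ₁ : 0 < δ₁) (hP : ∀ b, P b = 0) :
    IsEventuallyAffine atTop (mixedSoliton δ₁ δ₂ Ω P C) := by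
  refine IsEventuallyAffine.comp_neg ?_
  simp only [mixedSoliton_eq_maxWeight Ω C hP, Int.cast_neg, mul_neg, ← neg_mul]
  exact isEventuallyAffine_maxWeight
    (fun _ hi => append_eq_zero_of_append_dispK_eq_zero Ω hδ₁ (neg_eq_zero.mp hi)) C
    (inter δ₁ δ₂ Ω P)

end BoxBall

end MixedSoliton

end

theorem mainTheorem3 (δ₁ δ₂ : ℝ) (hδ₁ : 0 < δ₁) (hδ₂ : δ₁ < δ₂) (N M : ℕ)
    (Ω : Fin N → ℝ) (P : Fin M → ℝ) (C : Fin (N + M) → ℝ)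
    (F U V X : ℤ → ℤ → ℝ)
    (hF : F = MixedSoliton.mixedSoliton δ₁ δ₂ Ω P C)
    (hU : U = MixedSoliton.fieldU F)
    (hV : V = MixedSoliton.fieldV F)
    (hX : X = MixedSoliton.fieldX F) :
    MixedSoliton.SolvesEBB δ₁ δ₂ F ∧
    (M = 0 →
      (∀ m n : ℤ, -δ₂ + X m n + X m (n + 1) < 0) ∧
      (∀ m : ℤ, Filter.Tendsto (U m) Filter.atBot (nhds 0) ∧
        Filter.Tendsto (V m) Filter.atBot (nhds 0) ∧
        Filter.Tendsto (X m) Filter.atBot (nhds 0)) ∧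
      (∀ m n : ℤ, V m n = MixedSoliton.carrierLoad (U (m - 1)) (U m) n) ∧
      MixedSoliton.IsBoxBallEvolution δ₁ U) := by
  subst hF hU hV hX
  refine ⟨MixedSoliton.solvesEBB_mixedSoliton Ω P C hδ₁ hδ₂, ?_⟩
  rintro rfl
  have hP : ∀ b, P b = 0 := fun b => b.elim0
  have hX := MixedSoliton.fieldX_add_fieldX_le Ω C hδ₁ hδ₂ hP
  have hbot := MixedSoliton.isEventuallyAffine_atBot_mixedSoliton (δ₂ := δ₂) Ω C hδ₁ hP
  have htop := MixedSoliton.isEventuallyAffine_atTop_mixedSoliton (δ₂ := δ₂) Ω C hδ₁ hP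
  have hsucc : Filter.Tendsto (fun n : ℤ => n + 1) Filter.atBot Filter.atBot :=
    Filter.tendsto_atBot_add_const_right _ 1 Filter.tendsto_id
  have hpred : Filter.Tendsto (fun n : ℤ => n - 1) Filter.atBot Filter.atBot :=
    Filter.tendsto_atBot_add_const_right _ (-1) Filter.tendsto_id
  refine ⟨fun m n => by linarith [hX m n], fun m => ⟨?_, ?_, ?_⟩,
    fun m n => (MixedSoliton.carrierLoad_fieldU hbot m n).symm, ?_⟩
  · exact tendsto_nhds_of_eventually_eq (hbot.eventually_fieldU_eq_zero hsucc m)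
  · exact tendsto_nhds_of_eventually_eq (hbot.eventually_fieldV_eq_zero m)
  · exact tendsto_nhds_of_eventually_eq (hbot.eventually_fieldX_eq_zero hsucc hpred m)
  · exact MixedSoliton.isBoxBallEvolution_fieldU
      (MixedSoliton.solvesEBB_mixedSoliton Ω P C hδ₁ hδ₂) hδ₂.le hbot htop hX
      (MixedSoliton.fieldU_nonneg Ω C hδ₁ hδ₂ hP) (MixedSoliton.fieldU_le Ω C hδ₁ hδ₂ hP)
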